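/- Let $K$ be a field equipped with the trivial absolute value, and let $X$ be a regular projective curve over $\operatorname{Spec} K$ (an integral, regular projective $K$-scheme of dimension one) such that $\dim_{\mathbb Q}(\operatorname{Pic}(X)\otimes_{\mathbb Z}\mathbb Q)=1$. Write $X^{(1)}$ for the set of closed points of $X$, $\kappa(x)$ for the residue field of $x$, and $\operatorname{Rat}(X)$ for the field of rational functions. Let $X^{\mathrm{an}}$ be the Berkovich space of $X$: its points $\xi$ are the pairs consisting of a point $j(\xi)\in X$ and an absolute value $|\cdot|_\xi$ on the residue field of $j(\xi)$ which is trivial on $K$; its topology is the coarsest one for which $j$ is continuous and, for each regular function $f$ on a Zariski open $U\subseteq X$, the function $\xi\mapsto|f|(\xi)$ is continuous on $U^{\mathrm{an}}=j^{-1}(U)$. Let $\widehat C^0(X^{\mathrm{an}})$ be the set of real-valued continuous functions on sets $U^{\mathrm{an}}$, $U\subseteq X$ a non-empty Zariski open subset, two such functions being identified if they coincide on $V^{\mathrm{an}}$ for some non-empty Zariski open $V$. The map $s\mapsto\log|s|$ from $\operatorname{Rat}(X)^\times$ to $\widehat C^0(X^{\mathrm{an}})$ extends $\mathbb R$-linearly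 to $\operatorname{Rat}(X)^\times_{\mathbb R}=\operatorname{Rat}(X)^\times\otimes_{\mathbb Z}\mathbb R$. An *$\mathbb R$-Cartier divisor* is an element $D$ of $\operatorname{Div}(X)\otimes_{\mathbb Z}\mathbb R$, where $\operatorname{Div}(X)$ is the group of Cartier divisors; it is *effective* if it is a linear combination with positive real coefficients of effective Cartier divisors. A *Green function* of $D$ is an element $g\in\widehat C^0(X^{\mathrm{an}})$ such that, whenever $s\in\operatorname{Rat}(X)^\times_{\mathbb R}$ is a local equation of $D$ on a non-empty Zariski open $U$, the class $g+\log|s|$ extends to a continuous function on $U^{\mathrm{an}}$. An *adelic $\mathbb R$-Cartier divisor* is a pair $(D,g)$ of an $\mathbb R$-Cartier divisor $D$ and a Green function $g$ of $D$. It is *effective* if $D$ is effective and $g\geqslant 0$, where $g$ is regarded as the function $-\log(\mathrm e^{-g}):X^{\mathrm{an}}\to\mathbb R\cup\{+\infty\}$, $\mathrm e^{-g}$ being extended by continuity to $X^{\mathrm{an}}$. It satisfies the *Dirichlet property* if there is $s\in\operatorname{Rat}(X)^\times_{\mathbb R}$ such that $(D+(s),\,g-\log|s|)$ is effective. For $x\in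 X^{(1)}$ and $t\in\,]0,+\infty[$, let $\xi_{x,t}\in X^{\mathrm{an}}$ be the generic point of $X$ with the absolute value $\mathrm e^{-t\operatorname{ord}_x(\cdot)}$ on $\operatorname{Rat}(X)$. For a Green function $g$ put $$\mu_x(g)=\inf_{t>0}\frac{g(\xi_{x,t})}{t}\in\mathbb R\cup\{-\infty\},\qquad \mu_{\mathrm{tot}}(g)=\sum_{x\in X^{(1)}}\mu_x(g)\,[\kappa(x):K],$$ the sum being the integral with respect to the counting measure on $X^{(1)}$, that is, the sum of the positive parts minus the sum of the negative parts; it takes values in $[-\infty,+\infty[$. **Theorem.** Let $(D,g)$ be an adelic $\mathbb R$-Cartier divisor on $X$. The following conditions are equivalent. 1. $(D,g)$ satisfies the Dirichlet property. 2. One has $\mu_x(g)\geqslant 0$ for all but finitely many closed points $x$ of $X$, and $\mu_{\mathrm{tot}}(g)\geqslant 0$. -/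

import Mathlib

open AlgebraicGeometry CategoryTheory
open scoped TensorProduct Topology NNReal ENNReal

universe u

noncomputable section

namespace TrivArak

/-! ### Regular projective curves -/

section Curves

attribute [local instance] MvPolynomial.gradedAlgebra

/-- The structure morphism of `ℙⁿ` over `K`, with `ℙⁿ = Proj K[T₀, …, Tₙ]`. -/
def projSpaceHom (K : Type u) [Field K] (n : ℕ) :
    Proj (MvPolynomial.homogeneousSubmodule (Fin (n + 1)) K) ⟶ Spec (CommRingCat.of K) :=
  Proj.toSpecZero (MvPolynomial.homogeneousSubmodule (Fin (n + 1)) K) ≫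
    Spec.map (CommRingCat.ofHom
      (algebraMap K (MvPolynomial.homogeneousSubmodule (Fin (n + 1)) K 0)))

/-- `X` is projective over `K`: it is a closed subscheme of some `ℙⁿ` over `K`. -/
def IsProjectiveOver {K : Type u} [Field K] {X : Scheme.{u}}
    (π : X ⟶ Spec (CommRingCat.of K)) : Prop :=
  ∃ (n : ℕ) (i : X ⟶ Proj (MvPolynomial.homogeneousSubmodule (Fin (n + 1)) K)),
    IsClosedImmersion i ∧ i ≫ projSpaceHom K n = π

/-- A scheme is regular of dimension one: all its local rings are regular local rings and its
underlying space has Krull dimension one. -/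
class IsRegularCurve (X : Scheme.{u}) : Prop where
  regular : ∀ x : X, IsRegularLocalRing (X.presheaf.stalk x)
  dim_eq_one : topologicalKrullDim X = 1

/-- The set `X⁽¹⁾` of closed points of `X`. -/
abbrev ClosedPoint (X : Scheme.{u}) : Type u := {x : X // IsClosed ({x} : Set X)}

/-- The local ring of a regular integral curve at a closed point is a discrete valuation ring. -/
instance isDVR_stalk (X : Scheme.{u}) [IsIntegral X] [IsRegularCurve X] (x : ClosedPoint X) :
    IsDiscreteValuationRing (X.presheaf.stalk x.1) := by
  have hreg := IsRegularCurve.regular x.1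
  have hdim : ringKrullDim (X.presheaf.stalk x.1) = 1 := by
    have hle : ((Order.coheight x.1 : ℕ∞) : WithBot ℕ∞) ≤ 1 := by
      rw [← Order.coheight_orderIso
        (irreducibleSetEquivPoints (α := X)).symm x.1, ← IsRegularCurve.dim_eq_one (X := X)]
      exact Order.coheight_le_krullDim _
    rw [ringKrullDim_stalk_eq_coheight]
    refine le_antisymm hle ?_
    have hne : Order.coheight x.1 ≠ 0 := by
      intro h0
      have hmax : IsMax x.1 := Order.coheight_eq_zero.1 h0
      have hx : genericPoint X ∈ ({x.1} : Set X) :=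
        (hmax (genericPoint_specializes x.1)).mem_closed x.2 rfl
      have hsub : Subsingleton X := ⟨fun a b => by
        have key : ∀ c : X, c = x.1 := fun c =>
          ((Set.mem_singleton_iff.1 hx) ▸ genericPoint_specializes c).mem_closed x.2 rfl
        rw [key a, key b]⟩
      have := topologicalKrullDim_zero_of_discreteTopology X
      rw [IsRegularCurve.dim_eq_one] at this
      exact absurd this (by decide)
    exact_mod_cast Order.one_le_iff_ne_zero.2 hne
  have h1 := (IsRegularLocalRing.iff_finrank_cotangentSpace (X.presheaf.stalk x.1)).1 hreg
  rw [hdim] at h1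
  exact IsLocalRing.finrank_CotangentSpace_eq_one_iff.1 (by exact_mod_cast h1)

end Curves

/-! ### Cartier divisors and `ℝ`-Cartier divisors -/

section Divisors

variable (X : Scheme.{u}) [IsIntegral X]

/-- The image of `𝒪_{X,x}ˣ` in `Rat(X)ˣ`. -/
def localUnits (x : X) : Subgroup (X.functionField)ˣ :=
  (Units.map (algebraMap (X.presheaf.stalk x) X.functionField).toMonoidHom).range

/-- The group `Rat(X)ˣ/𝒪_{X,x}ˣ`. -/
def LocalClass (x : X) : Type u := (X.functionField)ˣ ⧸ localUnits X x

instance (x : X) : CommGroup (LocalClass X x) :=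
  inferInstanceAs (CommGroup ((X.functionField)ˣ ⧸ localUnits X x))

/-- The class in `Rat(X)ˣ/𝒪_{X,x}ˣ` of a rational function. -/
def classOf (x : X) : (X.functionField)ˣ →* LocalClass X x :=
  QuotientGroup.mk' (localUnits X x)

/-- The group `H⁰(X, 𝓜ˣ/𝒪ˣ)`. Since `X` is integral, the stalk of the quotient sheaf `𝓜ˣ/𝒪ˣ` at `x`
is `Rat(X)ˣ/𝒪_{X,x}ˣ`, and a global section of this sheaf is a family of germs which is locally
the family of classes of one rational function. -/
def cartierGroup : Subgroup (∀ x : X, LocalClass X x) where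
  carrier := {D | ∀ x : X, ∃ U : X.Opens, x ∈ U ∧ ∃ f : (X.functionField)ˣ,
    ∀ y ∈ U, D y = classOf X y f}
  one_mem' := fun _ => ⟨⊤, trivial, 1, fun _ _ => (map_one _).symm⟩
  mul_mem' := by
    intro D E hD hE x
    obtain ⟨U, hU, f, hf⟩ := hD x
    obtain ⟨V, hV, g, hg⟩ := hE x
    exact ⟨U ⊓ V, ⟨hU, hV⟩, f * g, fun y hy => by
      rw [Pi.mul_apply, hf y hy.1, hg y hy.2, map_mul]⟩
  inv_mem' := by
    intro D hD x
    obtain ⟨U, hU, f, hf⟩ := hD x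
    exact ⟨U, hU, f⁻¹, fun y hy => by rw [Pi.inv_apply, hf y hy, map_inv]⟩

/-- The group `Div(X)` of Cartier divisors, written additively. -/
abbrev CDiv : Type u := Additive (cartierGroup X)

/-- `Rat(X)ˣ`, written additively. -/
abbrev RatU : Type u := Additive (X.functionField)ˣ

/-- The principal divisor `f ↦ (f)`. -/
def principal : RatU X →+ CDiv X :=
  MonoidHom.toAdditive
    { toFun := fun f => ⟨fun x => classOf X x f, fun _ => ⟨⊤, trivial, f, fun _ _ => rfl⟩⟩
      map_one' := Subtype.ext (funext fun _ => map_one _)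
      map_mul' := fun _ _ => Subtype.ext (funext fun _ => map_mul _ _ _) }

/-- `Pic(X) = Div(X)/PDiv(X)`. -/
abbrev PicGroup : Type u := CDiv X ⧸ (principal X).range

/-- The group `Div_ℝ(X) = Div(X) ⊗ ℝ` of `ℝ`-Cartier divisors. -/
abbrev RDiv : Type u := ℝ ⊗[ℤ] CDiv X

/-- The group `Rat(X)ˣ_ℝ = Rat(X)ˣ ⊗ ℝ` of `ℝ`-rational functions. -/
abbrev RRat : Type u := ℝ ⊗[ℤ] RatU X

/-- The `ℝ`-principal divisor `s ↦ (s)`. -/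
def principalR : RRat X →ₗ[ℝ] RDiv X :=
  (principal X).toIntLinearMap.baseChange ℝ

/-- The germ at `x` of a Cartier divisor. -/
def germAt (x : X) : CDiv X →+ Additive (LocalClass X x) :=
  MonoidHom.toAdditive ((Pi.evalMonoidHom (LocalClass X) x).comp (cartierGroup X).subtype)

/-- The germ at `x` of the principal divisor of a rational function. -/
def classAt (x : X) : RatU X →+ Additive (LocalClass X x) :=
  MonoidHom.toAdditive (classOf X x)

variable {X}

/-- The `ℝ`-rational function `s` is a local equation on `U` of the `ℝ`-Cartier divisor `D`: at
each point `x` of `U`, they have the same class in `(Rat(X)ˣ/𝒪_{X,x}ˣ) ⊗ ℝ`. -/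
def IsLocalEquation (s : RRat X) (D : RDiv X) (U : X.Opens) : Prop :=
  ∀ x ∈ U, (germAt X x).toIntLinearMap.baseChange ℝ D =
    (classAt X x).toIntLinearMap.baseChange ℝ s

/-- A Cartier divisor is effective if it has local equations which are regular functions. -/
def IsEffectiveCartier (D : CDiv X) : Prop :=
  ∀ x : X, ∃ (U : X.Opens) (hx : x ∈ U) (a : Γ(X, U)) (f : (X.functionField)ˣ),
    (f : X.functionField) =
      algebraMap (X.presheaf.stalk x) X.functionField (X.presheaf.germ U x hx a) ∧
    ∀ y ∈ U, (Additive.toMul D).1 y = classOf X y f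

/-- An `ℝ`-Cartier divisor is effective if it is a linear combination with positive real
coefficients of effective Cartier divisors. -/
def IsEffectiveR (D : RDiv X) : Prop :=
  ∃ (r : ℕ) (a : Fin r → ℝ) (E : Fin r → CDiv X),
    (∀ i, 0 < a i) ∧ (∀ i, IsEffectiveCartier (E i)) ∧ D = ∑ i, a i ⊗ₜ[ℤ] E i

end Divisors

/-! ### The Berkovich space over a trivially valued field -/

section Berkovich

variable {K : Type u} [Field K] {X : Scheme.{u}}

/-- The homomorphism from `K` to the residue field `κ(x)` given by the structure morphism. -/
def toResidueField (π : X ⟶ Spec (CommRingCat.of K)) (x : X) : K →+* X.residueField x :=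
  (X.Γevaluation x).hom.comp
    (π.appTop.hom.comp (Scheme.ΓSpecIso (CommRingCat.of K)).inv.hom)

/-- The degree `[κ(x) : K]`. -/
def residueDegree (π : X ⟶ Spec (CommRingCat.of K)) (x : X) : ℕ :=
  letI := (toResidueField π x).toAlgebra
  Module.finrank K (X.residueField x)

/-- The Berkovich space `X^an` of a scheme `X` over the trivially valued field `K`: a point is a
point of `X` together with an absolute value on its residue field which extends the trivial
absolute value of `K`. -/
structure An (π : X ⟶ Spec (CommRingCat.of K)) where
  /-- the image under the specification map `j : X^an → X` -/
  pt : X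
  /-- the absolute value `|·|_ξ` on the residue field -/
  abv : AbsoluteValue (X.residueField pt) ℝ
  abv_trivial : ∀ a : K, a ≠ 0 → abv (toResidueField π pt a) = 1

/-- The Berkovich topology: the coarsest topology for which `j : X^an → X` is continuous and, for
each regular function `a` on a Zariski open `U`, the function `|a|` is continuous on the open set
`U^an = j⁻¹(U)`. (The sets with `V = univ` are the sets `j⁻¹(U)`.) -/
instance (π : X ⟶ Spec (CommRingCat.of K)) : TopologicalSpace (An π) :=
  TopologicalSpace.generateFrom
    {S | ∃ (U : X.Opens) (a : Γ(X, U)) (V : Set ℝ), IsOpen V ∧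
      S = {ξ : An π | ∃ h : ξ.pt ∈ U, ξ.abv (X.evaluation U ξ.pt h a) ∈ V}}

/-- `U^an = j⁻¹(U)`. -/
def anOpen (π : X ⟶ Spec (CommRingCat.of K)) (U : X.Opens) : Set (An π) :=
  {ξ | ξ.pt ∈ U}

variable [IsIntegral X] (π : X ⟶ Spec (CommRingCat.of K))

/-- The filter on `X^an` generated by the sets `U^an` with `U` a non-empty Zariski open subset
of `X` (the non-empty open subsets of `X` are the open neighbourhoods of its generic point). -/
def zariskiFilter : Filter (An π) :=
  Filter.comap An.pt (𝓝 (genericPoint X))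

/-- Real functions on `X^an`, two functions being identified if they coincide on `U^an` for some
non-empty Zariski open `U`. -/
abbrev AnGerm : Type u := Filter.Germ (zariskiFilter π) ℝ

variable {π}

/-- The class `g` extends to a continuous function on `U^an`. -/
def ExtendsTo (g : AnGerm π) (U : X.Opens) : Prop :=
  ∃ h : An π → ℝ, ContinuousOn h (anOpen π U) ∧ (h : AnGerm π) = g

/-- `g` belongs to `Ĉ⁰(X^an)`: it is the class of a continuous function on some non-empty Zariski
open subset of `X^an`. -/
def IsContinuousClass (g : AnGerm π) : Prop :=
  ∃ U : X.Opens, (U : Set X).Nonempty ∧ ExtendsTo g U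

open Classical in
/-- `|φ|(ξ)` for a rational function `φ` which is regular at `j(ξ)`; by convention it is `0` at
the other points. -/
def absAt (φ : X.functionField) (ξ : An π) : ℝ :=
  if h : ∃ a : X.presheaf.stalk ξ.pt, algebraMap (X.presheaf.stalk ξ.pt) X.functionField a = φ
  then ξ.abv (X.residue ξ.pt h.choose) else 0

lemma absAt_eq (ξ : An π) (a : X.presheaf.stalk ξ.pt) :
    absAt (algebraMap (X.presheaf.stalk ξ.pt) X.functionField a) ξ =
      ξ.abv (X.residue ξ.pt a) := by
  have h : ∃ b : X.presheaf.stalk ξ.pt, algebraMap (X.presheaf.stalk ξ.pt) X.functionField b =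
      algebraMap (X.presheaf.stalk ξ.pt) X.functionField a := ⟨a, rfl⟩
  rw [absAt, dif_pos h]
  have := IsFractionRing.injective (X.presheaf.stalk ξ.pt) X.functionField h.choose_spec
  rw [this]

lemma eventually_unit (f : (X.functionField)ˣ) :
    ∀ᶠ ξ in zariskiFilter π, ∃ a : (X.presheaf.stalk ξ.pt)ˣ,
      algebraMap (X.presheaf.stalk ξ.pt) X.functionField a = f := by
  obtain ⟨U, hU, s, hs⟩ := X.presheaf.exists_germ_eq (f : X.functionField)
  obtain ⟨V, hV, t, ht⟩ := X.presheaf.exists_germ_eq ((f⁻¹ : (X.functionField)ˣ) : X.functionField)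
  refine Filter.mem_comap.2 ⟨(U ⊓ V : X.Opens), (U ⊓ V).isOpen.mem_nhds ⟨hU, hV⟩, ?_⟩
  intro ξ hξ
  have : Nonempty U := ⟨⟨_, hU⟩⟩
  have : Nonempty V := ⟨⟨_, hV⟩⟩
  have hs' : algebraMap (X.presheaf.stalk ξ.pt) X.functionField (X.presheaf.germ U ξ.pt hξ.1 s) =
      f := by rw [Scheme.algebraMap_germ_eq_germToFunctionField]; exact hs
  have ht' : algebraMap (X.presheaf.stalk ξ.pt) X.functionField (X.presheaf.germ V ξ.pt hξ.2 t) =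
      (f⁻¹ : (X.functionField)ˣ) := by
    rw [Scheme.algebraMap_germ_eq_germToFunctionField]; exact ht
  have hmul : X.presheaf.germ U ξ.pt hξ.1 s * X.presheaf.germ V ξ.pt hξ.2 t = 1 := by
    apply IsFractionRing.injective (X.presheaf.stalk ξ.pt) X.functionField
    rw [map_mul, hs', ht', map_one, Units.mul_inv]
  exact ⟨Units.mkOfMulEqOne _ _ hmul, hs'⟩

variable (π) in
/-- The homomorphism `f ↦ log|f|` from `Rat(X)ˣ` to classes of functions on `X^an`. -/
def logAbs : RatU X →+ AnGerm π where
  toFun f := ((fun ξ => Real.log (absAt ((Additive.toMul f : (X.functionField)ˣ) :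
    X.functionField) ξ) : An π → ℝ) : AnGerm π)
  map_zero' := by
    refine Filter.Germ.coe_eq.2 (Filter.Eventually.of_forall fun ξ => ?_)
    have h := absAt_eq ξ (1 : X.presheaf.stalk ξ.pt)
    simp only [map_one] at h
    simp [h]
  map_add' f g := by
    refine Filter.Germ.coe_eq.2 ?_
    filter_upwards [eventually_unit (π := π) (Additive.toMul f),
      eventually_unit (π := π) (Additive.toMul g)] with ξ ⟨a, ha⟩ ⟨b, hb⟩
    have ha0 : ξ.abv (X.residue ξ.pt a) ≠ 0 :=
      (ξ.abv.ne_zero_iff).2 ((a.isUnit.map (X.residue ξ.pt).hom).ne_zero)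
    have hb0 : ξ.abv (X.residue ξ.pt b) ≠ 0 :=
      (ξ.abv.ne_zero_iff).2 ((b.isUnit.map (X.residue ξ.pt).hom).ne_zero)
    simp only [toMul_add, Units.val_mul]
    rw [← ha, ← hb, ← map_mul, absAt_eq, absAt_eq, absAt_eq, map_mul, map_mul,
      Real.log_mul ha0 hb0]

variable (π) in
/-- The `ℝ`-linear extension `s ↦ log|s|` to `Rat(X)ˣ_ℝ`. -/
def logAbsR : RRat X →ₗ[ℝ] AnGerm π :=
  (logAbs π).toIntLinearMap.liftBaseChange ℝ

/-! ### Adelic `ℝ`-Cartier divisors -/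

/-- `g` is a `D`-Green function of `C⁰`-type. -/
def IsGreen (D : RDiv X) (g : AnGerm π) : Prop :=
  IsContinuousClass g ∧
  ∀ (U : X.Opens) (s : RRat X), (U : Set X).Nonempty → IsLocalEquation s D U →
    ExtendsTo (g + logAbsR π s) U

variable (π) in
/-- An adelic `ℝ`-Cartier divisor `(D, g)` on `X`. -/
structure AdelicDivisor where
  D : RDiv X
  g : AnGerm π
  isGreen : IsGreen D g

/-- `(D, g)` is effective: `D` is effective, and `g`, regarded as the map `-log(e^{-g})` from `X^an`
to `ℝ ∪ {+∞}`, where `e^{-g}` is extended by continuity to `X^an`, is non-negative. -/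
def AdelicDivisor.IsEffective (A : AdelicDivisor π) : Prop :=
  IsEffectiveR A.D ∧
  ∃ h : C(An π, ℝ≥0),
    ((fun ξ => (h ξ : ℝ) : An π → ℝ) : AnGerm π) = A.g.map (fun r => Real.exp (-r)) ∧
    ∀ ξ, 0 ≤ -ENNReal.log (h ξ : ℝ≥0∞)

/-- `A` and `B` are `ℝ`-linearly equivalent: `B - A = ((s), -log|s|)` for some `s` in
`Rat(X)ˣ_ℝ`. -/
def AdelicDivisor.LinEquiv (A B : AdelicDivisor π) : Prop :=
  ∃ s : RRat X, B.D = A.D + principalR X s ∧ B.g = A.g - logAbsR π s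

/-- The Dirichlet property. -/
def AdelicDivisor.Dirichlet (A : AdelicDivisor π) : Prop :=
  ∃ B : AdelicDivisor π, A.LinEquiv B ∧ B.IsEffective

/-! ### The invariants `μ_x` and `μ_tot` -/

/-- The value of `g` at a point of `X^an` over the generic point of `X`. Such a point belongs to
`U^an` for each non-empty Zariski open `U`, so that the value is well defined. -/
def valueAt (g : AnGerm π) (ξ : An π) (hξ : ξ.pt = genericPoint X) : ℝ :=
  g.liftOn (fun F => F ξ) (by
    intro F G hFG
    obtain ⟨S, hS, hsub⟩ := Filter.mem_comap.1 hFG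
    exact hsub (show ξ.pt ∈ S by rw [hξ]; exact mem_of_mem_nhds hS))

variable (X) in
/-- The residue field at the generic point is the field of rational functions. -/
def genericResidueEquiv : X.functionField ≃+* X.residueField (genericPoint X) :=
  RingEquiv.ofBijective (X.residue (genericPoint X)).hom
    ⟨(X.residue (genericPoint X)).hom.injective, X.residue_surjective _⟩

lemma one_lt_exp_nnreal (t : Set.Ioi (0 : ℝ)) :
    (1 : ℝ≥0) < (Real.exp t.1).toNNReal :=
  Real.one_lt_toNNReal.2 (Real.one_lt_exp_iff.2 t.2)

/-- The absolute value `e^{-t ord_x(·)}` on `Rat(X)`, for a closed point `x` and `t > 0`. -/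
def ordAbv [IsRegularCurve X] (x : ClosedPoint X) (t : Set.Ioi (0 : ℝ)) :
    AbsoluteValue X.functionField ℝ :=
  (IsDiscreteValuationRing.maximalIdeal (X.presheaf.stalk x.1)).adicAbv (K := X.functionField)
    (one_lt_exp_nnreal t)

variable (π) in
/-- The point of parameter `t ∈ ]0, +∞[` on the branch `]η₀, x[` of `X^an`: the generic point
of `X` with the absolute value `e^{-t ord_x(·)}` on `Rat(X)`. -/
def branchPoint [IsRegularCurve X] (x : ClosedPoint X) (t : Set.Ioi (0 : ℝ)) : An π where
  pt := genericPoint X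
  abv := (ordAbv x t).comp (f := (genericResidueEquiv X).symm.toRingHom)
    (genericResidueEquiv X).symm.injective
  abv_trivial := by
    intro a ha
    let c : K →+* X.presheaf.stalk x.1 := (X.presheaf.germ ⊤ x.1 trivial).hom.comp
      (π.appTop.hom.comp (Scheme.ΓSpecIso (CommRingCat.of K)).inv.hom)
    have hc : genericResidueEquiv X (algebraMap (X.presheaf.stalk x.1) X.functionField (c a)) =
        toResidueField π (genericPoint X) a := by
      have : Nonempty (⊤ : X.Opens) := ⟨⟨genericPoint X, trivial⟩⟩
      exact congrArg (genericResidueEquiv X)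
        (Scheme.algebraMap_germ_eq_germToFunctionField (X := X)
          (show x.1 ∈ (⊤ : X.Opens) from trivial) (π.appTop.hom
            ((Scheme.ΓSpecIso (CommRingCat.of K)).inv.hom a)))
    change ordAbv x t ((genericResidueEquiv X).symm (toResidueField π (genericPoint X) a)) = 1
    rw [← hc, RingEquiv.symm_apply_apply]
    refine (IsDedekindDomain.HeightOneSpectrum.adicAbv_coe_eq_one_iff _ _ (c a)).2 ?_
    intro hmem
    exact (IsLocalRing.mem_maximalIdeal _).1 hmem ((IsUnit.mk0 a ha).map c)

/-- `μ_x(g) = inf_{ξ ∈ ]η₀, x[} g(ξ)/t(ξ)`, an element of `ℝ ∪ {-∞}`. -/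
def mu [IsRegularCurve X] (g : AnGerm π) (x : ClosedPoint X) : EReal :=
  ⨅ t : Set.Ioi (0 : ℝ), ((valueAt g (branchPoint π x t) rfl / t.1 : ℝ) : EReal)

/-- `μ_tot(g) = ∑_x μ_x(g) [κ(x) : K]`, the sum being the integral with respect to the counting
measure on the set of closed points, that is, the sum of the positive parts minus the sum of the
negative parts. -/
def muTot [IsRegularCurve X] (g : AnGerm π) : EReal :=
  ((∑' x : ClosedPoint X, (mu g x * (residueDegree π x.1 : EReal)).toENNReal : ℝ≥0∞) : EReal) -
  ((∑' x : ClosedPoint X, (-(mu g x * (residueDegree π x.1 : EReal))).toENNReal : ℝ≥0∞) : EReal)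

end Berkovich

end TrivArak

end

/-!
# The Dirichlet property on a curve over a trivially valued field

Two facts link the Green function `g` of `(D, g)` to divisors. On the branch `]η₀, x[` of a closed
point `x`, one has `log|s|(ξ_{x,t}) = -t ord_x(s)` (`valueAt_logAbsR_branchPoint`), and the slope
`g(ξ_{x,t})/t` tends to the multiplicity of `D` at `x` for `t → ∞`, whence
`μ_x(g) ≤ ord_x(D)` (`mu_le_ordDiv`). Moreover, `∑ ord_x(s) [κ(x) : K] = 0` for each `s` in
`Rat(X)ˣ_ℝ` (`sum_ordRat_mul_residueDegree`).

If `(D + (s), g - log|s|)` is effective, then `g ≥ log|s|` over the generic point, so that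
`μ_x(g) ≥ -ord_x(s)`. The bounds vanish for almost all `x` and have degree zero
(`conditions_of_dirichlet`).

Conversely, if `μ_x(g) ≥ 0` for almost all `x`, then `0 ≤ μ_x(g) ≤ ord_x(D) = 0` for almost all `x`,
so that `∑ μ_x(g) x` is an `ℝ`-divisor `M`, of degree `μ_tot(g) ≥ 0` (`exists_real_mu`). As the Picard
group has rank one, an `ℝ`-divisor of degree zero is principal
(`exists_principalR_eq_of_degree_eq_zero`); removing from `M` a non-negative multiple of one point
yields `s` with `ord_x(s) ≤ μ_x(g)` for each `x` (`exists_ordRat_le`). Then `D - (s)` has non-negative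
multiplicities, and `g + log|s|` is non-negative on the branches. The points of `X^an` over the
generic point of `X` are `η₀` and the points of the branches (`genericFibre_classification`); they
are dense in `X^an`, and `e^{-(g + log|s|)}` has a limit `≤ 1` at each remaining point: near `x` it is
the product of a continuous function and of `|ϖ| ^ c`, where `ϖ` is a uniformizer at `x` and `c ≥ 0`
is the multiplicity of `D - (s)` (`isEffective_of_nonneg`).

Three ingredients of the theory of curves are proved along the way.
* The degree formula `sum_dvrOrd_mul_degree` holds for a field `F` with a family of discrete
  valuation rings. If `f` has zeros of total degree `N`, weak approximation yields `N` functions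
  `u_j` independent modulo `f`, hence independent over `K[f]`. The functions `f ^ t u_j` with `t < l`
  have poles bounded by `l (f)_∞ + C`, and such functions form a space of dimension at most
  `l deg (f)_∞` up to a constant. Thus `N ≤ deg (f)_∞`, and equality follows by passing to `f⁻¹`.
* The hypotheses of this formula for the local rings of `X`, and the classification of the absolute
  values of `Rat(X)` trivial on `K` (`abv_classification`), come from the valuative criteria of
  separatedness and properness.
* A Cartier divisor on a regular curve is determined by its multiplicities, and each closed point is
  an effective Cartier divisor (`eq_sum_pointDivisor`).
-/

noncomputable section

namespace TrivArak

/-! ### The degree formula for a family of discrete valuation rings -/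

section DegreeFormula

open WithZero

section OneValuation

variable {K F : Type*} [Field K] [Field F] [Algebra K F]
  (A : Type*) [CommRing A] [IsDomain A] [IsDiscreteValuationRing A]
  [Algebra A F] [IsFractionRing A F]

variable (F) in
/-- The normalised valuation, with values in `ℤᵐ⁰`, of the fraction field `F` of a discrete
valuation ring `A`. -/
abbrev dvrVal : Valuation F ℤᵐ⁰ := (IsDiscreteValuationRing.maximalIdeal A).valuation F

/-- The order of an element of the fraction field of a discrete valuation ring `A`; the order of
`0` is `0` by convention. -/
def dvrOrd (f : F) : ℤ := -log (dvrVal F A f)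

variable {A}

lemma dvrVal_eq_exp {f : F} (hf : f ≠ 0) : dvrVal F A f = exp (-dvrOrd A f) := by
  rw [dvrOrd, neg_neg, exp_log ((Valuation.ne_zero_iff _).2 hf)]

lemma dvrOrd_mul {f g : F} (hf : f ≠ 0) (hg : g ≠ 0) :
    dvrOrd A (f * g) = dvrOrd A f + dvrOrd A g := by
  rw [dvrOrd, map_mul, log_mul ((Valuation.ne_zero_iff _).2 hf) ((Valuation.ne_zero_iff _).2 hg)]
  simp only [dvrOrd]; ring

lemma dvrOrd_inv (f : F) : dvrOrd A f⁻¹ = -dvrOrd A f := by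
  rw [dvrOrd, map_inv₀, log_inv, dvrOrd]

lemma dvrVal_le_exp_neg_iff {f : F} (hf : f ≠ 0) {n : ℤ} :
    dvrVal F A f ≤ exp n ↔ -n ≤ dvrOrd A f := by
  rw [dvrVal_eq_exp hf, exp_le_exp]; omega

lemma dvrVal_le_one_iff {f : F} : dvrVal F A f ≤ 1 ↔ ∃ a : A, algebraMap A F a = f := by
  refine ⟨IsDiscreteValuationRing.exists_lift_of_le_one, ?_⟩
  rintro ⟨a, rfl⟩
  exact IsDedekindDomain.HeightOneSpectrum.valuation_le_one _ a

lemma dvrVal_algebraMap_lt_one_iff {a : A} :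
    dvrVal F A (algebraMap A F a) < 1 ↔ IsLocalRing.residue A a = 0 := by
  rw [IsDedekindDomain.HeightOneSpectrum.valuation_lt_one_iff_mem,
    IsLocalRing.residue_eq_zero_iff]
  rfl

lemma lt_exp_iff {x : ℤᵐ⁰} {n : ℤ} : x < exp n ↔ x ≤ exp (n - 1) := by
  rcases eq_or_ne x 0 with rfl | hx
  · simp
  · rw [← exp_log hx, exp_lt_exp, exp_le_exp]; omega

lemma lt_one_iff_le_exp {x : ℤᵐ⁰} : x < 1 ↔ x ≤ exp (-1) := by
  rw [← exp_zero, lt_exp_iff, zero_sub]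

variable (A F) in
lemma exists_uniformizer : ∃ ϖ : A, dvrVal F A (algebraMap A F ϖ) = exp (-1) := by
  obtain ⟨ϖ, h⟩ := (IsDiscreteValuationRing.maximalIdeal A).intValuation_exists_uniformizer
  exact ⟨ϖ, by rw [IsDedekindDomain.HeightOneSpectrum.valuation_of_algebraMap, h]⟩

variable [Algebra K A] [IsScalarTower K A F]

/-- On a space of functions with pole order at most `n` at one place, taking the leading
coefficient is linear with values in the residue field. -/
lemma exists_leadingCoeff (M : Submodule K F) (n : ℤ) (hM : ∀ f ∈ M, dvrVal F A f ≤ exp n) :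
    ∃ φ : M →ₗ[K] IsLocalRing.ResidueField A,
      ∀ f : M, φ f = 0 → dvrVal F A (f : F) ≤ exp (n - 1) := by
  obtain ⟨ϖ, hϖ⟩ := exists_uniformizer F A
  have hϖ0 : algebraMap A F ϖ ≠ 0 := by
    intro h; rw [h, map_zero] at hϖ; exact exp_ne_zero hϖ.symm
  have hpow : dvrVal F A (algebraMap A F ϖ ^ n) = exp (-n) := by
    rw [map_zpow₀, hϖ, ← exp_zsmul]; simp
  have hint : ∀ f : M, ∃ a : A, algebraMap A F a = f * algebraMap A F ϖ ^ n := by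
    intro f
    rw [← dvrVal_le_one_iff, map_mul, hpow]
    calc _ ≤ exp n * exp (-n) := mul_le_mul_left (hM f f.2) _
      _ = 1 := by rw [← exp_add, add_neg_cancel, exp_zero]
  choose a ha using hint
  have hinj := IsFractionRing.injective A F
  refine ⟨(IsScalarTower.toAlgHom K A (IsLocalRing.ResidueField A)).toLinearMap ∘ₗ
    { toFun := a
      map_add' := fun f g => hinj (by rw [map_add, ha, ha, ha, Submodule.coe_add, add_mul])
      map_smul' := fun c f => hinj (by
        rw [RingHom.id_apply, Algebra.smul_def, map_mul, ha, ha,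
          ← IsScalarTower.algebraMap_apply, Submodule.coe_smul, Algebra.smul_def, mul_assoc]) }, ?_⟩
  intro f hf
  have h1 : dvrVal F A (algebraMap A F (a f)) < 1 := dvrVal_algebraMap_lt_one_iff.2 hf
  rw [ha, map_mul, hpow, lt_one_iff_le_exp] at h1
  calc dvrVal F A (f : F) = dvrVal F A (f : F) * exp (-n) * exp n := by
        rw [mul_assoc, ← exp_add, neg_add_cancel, exp_zero, mul_one]
    _ ≤ exp (-1) * exp n := mul_le_mul_left h1 _
    _ = exp (n - 1) := by rw [← exp_add]; congr 1; ring

omit [Algebra A F] [IsFractionRing A F] [IsScalarTower K A F] [Field F] [Algebra K F] in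
/-- If `θ` lifts a basis of the residue field and `ϖ` is a uniformizer, then the products
`ϖᵐ θ_b`, `m < n`, are linearly independent modulo `ϖⁿ`. -/
lemma uniformizer_expansion_injective {β : Type*} [Fintype β] {ϖ : A} (hϖ : ϖ ≠ 0)
    (hϖ' : IsLocalRing.residue A ϖ = 0) {θ : β → A}
    (hθ : LinearIndependent K fun b => IsLocalRing.residue A (θ b)) (n : ℕ)
    (c : Fin n → β → K) (h : ϖ ^ n ∣ ∑ m, ∑ b, algebraMap K A (c m b) * (ϖ ^ (m : ℕ) * θ b)) :
    c = 0 := by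
  induction n with
  | zero => exact Subsingleton.elim _ _
  | succ n ih =>
    have hsplit : ∑ m, ∑ b, algebraMap K A (c m b) * (ϖ ^ (m : ℕ) * θ b) =
        ∑ b, algebraMap K A (c 0 b) * θ b +
          ϖ * ∑ m : Fin n, ∑ b, algebraMap K A (c m.succ b) * (ϖ ^ (m : ℕ) * θ b) := by
      rw [Fin.sum_univ_succ, Finset.mul_sum]
      congr 1
      · simp
      · refine Finset.sum_congr rfl fun m _ => ?_
        rw [Finset.mul_sum]
        refine Finset.sum_congr rfl fun b _ => ?_
        rw [Fin.val_succ, pow_succ]; ring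
    rw [hsplit] at h
    have h0 : ∀ b, c 0 b = 0 := by
      refine Fintype.linearIndependent_iff.1 hθ (c 0) ?_
      obtain ⟨d, hd⟩ := h
      have := congrArg (IsLocalRing.residue A) hd
      simp only [map_add, map_mul, map_pow, map_sum, hϖ', zero_mul, add_zero, ne_eq,
        Nat.add_eq_zero_iff, one_ne_zero, and_false, not_false_eq_true, zero_pow] at this
      rw [← this]
      refine Finset.sum_congr rfl fun b _ => ?_
      rw [Algebra.smul_def]; rfl
    simp only [h0, map_zero, zero_mul, Finset.sum_const_zero, zero_add] at h
    rw [pow_succ'] at h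
    have := ih (fun m b => c m.succ b) ((mul_dvd_mul_iff_left hϖ).1 h)
    funext m b
    refine Fin.cases (h0 b) (fun m => ?_) m
    exact congrFun (congrFun this m) b

end OneValuation

section Family

variable {K F ι : Type*} [Field K] [Field F] [Algebra K F]
  (A : ι → Type*) [∀ i, CommRing (A i)] [∀ i, IsDomain (A i)]
  [∀ i, IsDiscreteValuationRing (A i)]
  [∀ i, Algebra (A i) F] [∀ i, IsFractionRing (A i) F]

section Approximation

/-- Weak approximation for finitely many discrete valuation rings of `F`, none of which contains
another. -/
lemma weak_approximation (hne : ∀ i j, i ≠ j → ∃ f : F, dvrVal F (A i) f ≤ 1 ∧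
    ¬ dvrVal F (A j) f ≤ 1) (S : Finset ι) (z : ι → F) (n : ℕ) :
    ∃ f : F, ∀ i ∈ S, dvrVal F (A i) (f - z i) ≤ exp (-(n : ℤ)) := by
  have hb : (1 : ℝ≥0) < 2 := one_lt_two
  let w : S → AbsoluteValue F ℝ := fun i =>
    (IsDiscreteValuationRing.maximalIdeal (A i)).adicAbv (K := F) hb
  have hw : ∀ (i : S) (f : F), w i f =
      WithZeroMulInt.toNNReal (ne_zero_of_lt hb) (dvrVal F (A i) f) := fun i f => rfl
  have hle : ∀ (i : S) (f : F) (m : ℤ), w i f ≤ (2 : ℝ) ^ m ↔ dvrVal F (A i) f ≤ exp m := by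
    intro i f m
    have hm : (2 : ℝ) ^ m = (WithZeroMulInt.toNNReal (ne_zero_of_lt hb) (exp m) : ℝ≥0) := by
      rw [WithZeroMulInt.toNNReal_neg_apply _ exp_ne_zero, toAdd_unzero_eq_log, log_exp]
      simp
    rw [hw, hm, NNReal.coe_le_coe, (WithZeroMulInt.toNNReal_strictMono hb).le_iff_le]
  have hle1 : ∀ (i : S) (f : F), w i f ≤ 1 ↔ dvrVal F (A i) f ≤ 1 := by
    intro i f; simpa using hle i f 0
  have hnt : ∀ i, (w i).IsNontrivial := by
    intro i
    obtain ⟨ϖ, hϖ⟩ := exists_uniformizer F (A i)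
    refine ⟨algebraMap (A i) F ϖ, fun h => ?_, fun h => ?_⟩
    · rw [h, map_zero] at hϖ; exact exp_ne_zero hϖ.symm
    · have h2 := (hle i (algebraMap (A i) F ϖ) (-1)).2 hϖ.le
      rw [h] at h2; norm_num at h2
  have hpw : Pairwise fun i j => ¬ (w i).IsEquiv (w j) := by
    intro i j hij h
    obtain ⟨f, h1, h2⟩ := hne i j fun h => hij (Subtype.ext h)
    exact h2 ((hle1 j f).1 (h.le_one_iff.1 ((hle1 i f).2 h1)))
  obtain ⟨f, hf⟩ := Metric.denseRange_iff.1 (AbsoluteValue.denseRange_algebraMap_pi hnt hpw)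
    (fun i => (WithAbs.equiv (w i)).symm (z i)) ((2 : ℝ) ^ (-(n : ℤ))) (by positivity)
  refine ⟨f, fun i hi => (hle ⟨i, hi⟩ _ _).1 ?_⟩
  have h1 := (dist_le_pi_dist _ _ (⟨i, hi⟩ : S)).trans hf.le
  rw [dist_comm, dist_eq_norm] at h1
  exact h1

end Approximation

variable [∀ i, Algebra K (A i)] [∀ i, IsScalarTower K (A i) F]

lemma dvrVal_const_le_one (i : ι) (c : K) : dvrVal F (A i) (algebraMap K F c) ≤ 1 :=
  dvrVal_le_one_iff.2 ⟨algebraMap K (A i) c, (IsScalarTower.algebraMap_apply K (A i) F c).symm⟩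

variable (K F) in
/-- The space of the `f ∈ F` whose pole order at the place `i` is at most `D i`. -/
def rrSpace (D : ι → ℤ) : Submodule K F where
  carrier := {f | ∀ i, dvrVal F (A i) f ≤ exp (D i)}
  zero_mem' i := by simp
  add_mem' hf hg i := (Valuation.map_add _ _ _).trans (max_le (hf i) (hg i))
  smul_mem' c f hf i := by
    rw [Algebra.smul_def, map_mul]
    exact (mul_le_mul' (dvrVal_const_le_one A i c) (hf i)).trans (one_mul _).le

variable [∀ i, Module.Finite K (IsLocalRing.ResidueField (A i))]

/-- Allowing one more pole at a place of degree `d` raises the dimension by at most `d`. -/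
lemma finrank_rrSpace_add_single [DecidableEq ι] (D : ι → ℤ) (i : ι)
    [Module.Finite K (rrSpace K F A D)] :
    Module.Finite K (rrSpace K F A (D + Pi.single i 1)) ∧
      Module.finrank K (rrSpace K F A (D + Pi.single i 1)) ≤
        Module.finrank K (rrSpace K F A D) +
          Module.finrank K (IsLocalRing.ResidueField (A i)) := by
  obtain ⟨φ, hφ⟩ := exists_leadingCoeff (K := K) (A := A i) (rrSpace K F A (D + Pi.single i 1))
    (D i + 1) (fun f hf => by simpa using hf i)
  have hker : ∀ f ∈ LinearMap.ker φ, (f : F) ∈ rrSpace K F A D := by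
    intro f hf j
    rcases eq_or_ne j i with rfl | hj
    · simpa using hφ f hf
    · simpa [Pi.single_eq_of_ne hj] using f.2 j
  let ψ : LinearMap.ker φ →ₗ[K] rrSpace K F A D :=
    { toFun := fun f => ⟨(f : rrSpace K F A (D + Pi.single i 1)), hker f f.2⟩
      map_add' := fun _ _ => rfl
      map_smul' := fun _ _ => rfl }
  have hψ : Function.Injective ψ := fun f g h => by
    have := congrArg (Subtype.val) h
    exact Subtype.ext (Subtype.ext this)
  have hfk : Module.Finite K (LinearMap.ker φ) := Module.Finite.of_injective ψ hψ
  have hfr : Module.Finite K (LinearMap.range φ) := inferInstance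
  have hfin : Module.Finite K (rrSpace K F A (D + Pi.single i 1)) := by
    have := Module.Finite.equiv φ.quotKerEquivRange.symm
    exact Module.Finite.of_submodule_quotient (LinearMap.ker φ)
  refine ⟨hfin, ?_⟩
  rw [← LinearMap.finrank_range_add_finrank_ker φ, add_comm]
  exact add_le_add (LinearMap.finrank_le_finrank_of_injective hψ) (Submodule.finrank_le _)

/-- The dimension of the space attached to an effective divisor `E` exceeds that of the space of
constants by at most the degree of `E`. -/
lemma finrank_rrSpace_le [DecidableEq ι] [Module.Finite K (rrSpace K F A 0)] (E : Multiset ι) :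
    Module.Finite K (rrSpace K F A fun i => (E.count i : ℤ)) ∧
      Module.finrank K (rrSpace K F A fun i => (E.count i : ℤ)) ≤
        Module.finrank K (rrSpace K F A 0) +
          (E.map fun i => Module.finrank K (IsLocalRing.ResidueField (A i))).sum := by
  induction E using Multiset.induction with
  | empty =>
    have : (fun i => ((0 : Multiset ι).count i : ℤ)) = 0 := by funext i; simp
    rw [this]
    exact ⟨inferInstance, by simp⟩
  | cons a E ih =>
    obtain ⟨h1, h2⟩ := ih
    have : (fun i => ((a ::ₘ E).count i : ℤ)) = (fun i => (E.count i : ℤ)) + Pi.single a 1 := by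
      funext i
      rw [Multiset.count_cons, Pi.add_apply, Pi.single_apply]
      split_ifs <;> simp
    rw [this]
    obtain ⟨h3, h4⟩ := finrank_rrSpace_add_single (K := K) (F := F) A
      (fun i => (E.count i : ℤ)) a
    refine ⟨h3, h4.trans ?_⟩
    rw [Multiset.map_cons, Multiset.sum_cons]
    omega

/-- Finitely many functions have a common bound for their poles. -/
lemma exists_pole_bound [DecidableEq ι]
    (hfin : ∀ g : F, g ≠ 0 → {i | dvrOrd (A i) g ≠ 0}.Finite) {J : Type*} [Fintype J]
    (u : J → F) :
    ∃ C : Multiset ι, ∀ j i, dvrVal F (A i) (u j) ≤ exp (C.count i : ℤ) := by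
  have h1 : ∀ g : F, ∃ C : Multiset ι, ∀ i, dvrVal F (A i) g ≤ exp (C.count i : ℤ) := by
    intro g
    rcases eq_or_ne g 0 with rfl | hg
    · exact ⟨0, fun i => by simp⟩
    · refine ⟨∑ i ∈ (hfin g hg).toFinset, Multiset.replicate (-dvrOrd (A i) g).toNat i,
        fun i => ?_⟩
      rw [dvrVal_le_exp_neg_iff hg, Multiset.count_sum']
      simp only [Multiset.count_replicate, Finset.sum_ite_eq', Set.Finite.mem_toFinset,
        Set.mem_ofPred_eq]
      split_ifs with h <;> omega
  choose C hC using h1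
  refine ⟨∑ j, C (u j), fun j i => (hC (u j) i).trans (exp_le_exp.2 ?_)⟩
  rw [Multiset.count_sum']
  exact_mod_cast Finset.single_le_sum (f := fun j => (C (u j)).count i)
    (fun _ _ => Nat.zero_le _) (Finset.mem_univ j)

omit [∀ i, Module.Finite K (IsLocalRing.ResidueField (A i))] in
/-- Let `f` vanish to order at least `Z i` at each `i ∈ S`. If functions `u_j` are integral at `S`
and linearly independent over `K` modulo the functions vanishing to these orders, then the
products `f ^ t * u_j` are linearly independent: the terms of lowest degree in `f` vanish first. -/
lemma pow_mul_injective {f : F} (hf : f ≠ 0) {S : Finset ι} {Z : ι → ℕ}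
    (hfS : ∀ i ∈ S, dvrVal F (A i) f ≤ exp (-(Z i : ℤ)))
    {J : Type*} [Fintype J] {u : J → F} (hu1 : ∀ j, ∀ i ∈ S, dvrVal F (A i) (u j) ≤ 1)
    (hu : ∀ c : J → K, (∀ i ∈ S, dvrVal F (A i) (∑ j, c j • u j) ≤ exp (-(Z i : ℤ))) → c = 0)
    (l : ℕ) (c : Fin l → J → K) (h : ∑ t, ∑ j, c t j • (f ^ (t : ℕ) * u j) = 0) : c = 0 := by
  induction l with
  | zero => exact Subsingleton.elim _ _
  | succ l ih =>
    have hsplit : ∑ t, ∑ j, c t j • (f ^ (t : ℕ) * u j) =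
        ∑ j, c 0 j • u j + f * ∑ t : Fin l, ∑ j, c t.succ j • (f ^ (t : ℕ) * u j) := by
      rw [Fin.sum_univ_succ, Finset.mul_sum]
      congr 1
      · simp
      · refine Finset.sum_congr rfl fun t _ => ?_
        rw [Finset.mul_sum]
        refine Finset.sum_congr rfl fun j _ => ?_
        rw [Fin.val_succ, pow_succ, Algebra.smul_def, Algebra.smul_def]; ring
    rw [hsplit] at h
    have h0 : c 0 = 0 := by
      refine hu _ fun i hi => ?_
      rw [eq_neg_of_add_eq_zero_left h, Valuation.map_neg, map_mul]
      refine (mul_le_mul' (hfS i hi) ?_).trans (mul_one _).le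
      refine Valuation.map_sum_le _ fun t _ => Valuation.map_sum_le _ fun j _ => ?_
      rw [Algebra.smul_def, map_mul, map_mul, map_pow]
      refine mul_le_one' (dvrVal_const_le_one A i _) (mul_le_one' (pow_le_one' ?_ _) (hu1 j i hi))
      exact (hfS i hi).trans (by rw [← exp_zero, exp_le_exp]; omega)
    simp only [h0, Pi.zero_apply, zero_smul, Finset.sum_const_zero, zero_add, mul_eq_zero, hf,
      false_or] at h
    have := ih _ h
    funext t
    exact Fin.cases h0 (fun t => congrFun this t) t

variable (K) in
/-- Let `d_i` be the degree of the place `i`. There are `∑ i ∈ S, Z i * d_i` functions which are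
integral at `S` and linearly independent modulo the functions vanishing to order at least `Z i` at
each `i ∈ S`: they approximate, at one place `i` of `S` each, the products of a power `m < Z i` of
a uniformizer and a lift of an element of a basis of the residue field, and `0` at the others. -/
lemma exists_independent_mod (hne : ∀ i j, i ≠ j → ∃ f : F, dvrVal F (A i) f ≤ 1 ∧
    ¬ dvrVal F (A j) f ≤ 1) (S : Finset ι) (Z : ι → ℕ) :
    ∃ u : (Σ i : S, Fin (Z i) × Fin (Module.finrank K (IsLocalRing.ResidueField (A i)))) → F,
      (∀ j, ∀ i ∈ S, dvrVal F (A i) (u j) ≤ 1) ∧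
      ∀ c : _ → K, (∀ i ∈ S, dvrVal F (A i) (∑ j, c j • u j) ≤ exp (-(Z i : ℤ))) → c = 0 := by
  classical
  choose ϖ hϖ using fun i => exists_uniformizer F (A i)
  have hlift : ∀ i, ∃ θ : Fin (Module.finrank K (IsLocalRing.ResidueField (A i))) → A i,
      ∀ b, IsLocalRing.residue (A i) (θ b) =
        Module.finBasis K (IsLocalRing.ResidueField (A i)) b :=
    fun i => ⟨fun b => (IsLocalRing.residue_surjective _).choose,
      fun b => (IsLocalRing.residue_surjective _).choose_spec⟩
  choose θ hθ using hlift
  let z : (Σ i : S, Fin (Z i) × Fin (Module.finrank K (IsLocalRing.ResidueField (A i)))) → ι → F :=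
    fun j i => if h : i = j.1 then
      algebraMap (A j.1) F (ϖ j.1 ^ (j.2.1 : ℕ) * θ j.1 j.2.2) else 0
  have hz1 : ∀ j i, dvrVal F (A i) (z j i) ≤ 1 := by
    intro j i
    by_cases h : i = j.1
    · subst h
      simp only [z, dif_pos]
      exact dvrVal_le_one_iff.2 ⟨_, rfl⟩
    · simp [z, h]
  choose u hu using fun j => weak_approximation A hne S (z j) (S.sup Z)
  have hsup : ∀ i ∈ S, exp (-((S.sup Z : ℕ) : ℤ)) ≤ exp (-(Z i : ℤ)) := by
    intro i hi
    rw [exp_le_exp, neg_le_neg_iff]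
    exact_mod_cast Finset.le_sup hi
  refine ⟨u, fun j i hi => ?_, fun c hc => ?_⟩
  · rw [← sub_add_cancel (u j) (z j i)]
    refine (Valuation.map_add _ _ _).trans (max_le ((hu j i hi).trans ?_) (hz1 j i))
    rw [← exp_zero, exp_le_exp]; omega
  · funext ⟨i, m, b⟩
    have hi := i.2
    have h1 : dvrVal F (A i) (∑ j, c j • z j i) ≤ exp (-(Z i : ℤ)) := by
      have : ∑ j, c j • z j i = ∑ j, c j • u j - ∑ j, c j • (u j - z j i) := by
        rw [← Finset.sum_sub_distrib]
        exact Finset.sum_congr rfl fun j _ => by rw [← smul_sub, sub_sub_cancel]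
      rw [this]
      refine (Valuation.map_sub _ _ _).trans (max_le (hc i hi) ?_)
      refine Valuation.map_sum_le _ fun j _ => ?_
      rw [Algebra.smul_def, map_mul]
      exact (mul_le_mul' (dvrVal_const_le_one A i _) ((hu j i hi).trans (hsup i hi))).trans
        (one_mul _).le
    have h2 : ∑ j, c j • z j i = algebraMap (A i) F (∑ m : Fin (Z i), ∑ b,
        algebraMap K (A i) (c ⟨i, m, b⟩) * (ϖ i ^ (m : ℕ) * θ i b)) := by
      rw [Fintype.sum_sigma, Finset.sum_eq_single i]
      · rw [Fintype.sum_prod_type, map_sum]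
        refine Finset.sum_congr rfl fun m _ => ?_
        rw [map_sum]
        refine Finset.sum_congr rfl fun b _ => ?_
        simp only [z, dif_pos]
        rw [Algebra.smul_def, map_mul (algebraMap (A i) F) (algebraMap K (A i) _),
          ← IsScalarTower.algebraMap_apply]
      · intro k _ hk
        refine Finset.sum_eq_zero fun p _ => ?_
        have : ¬ (i : ι) = k := fun h => hk (Subtype.ext h.symm)
        simp [z, this]
      · exact fun h => absurd (Finset.mem_univ i) h
    have hϖ0 : ϖ i ≠ 0 := by
      intro h; have := hϖ i; rw [h, map_zero, map_zero] at this; exact exp_ne_zero this.symm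
    have hϖ0' : algebraMap (A i) F (ϖ i) ≠ 0 :=
      (map_ne_zero_iff _ (IsFractionRing.injective (A i) F)).2 hϖ0
    have hdvd : ∀ a : A i, dvrVal F (A i) (algebraMap (A i) F a) ≤ exp (-(Z i : ℤ)) →
        ϖ i ^ Z i ∣ a := by
      intro a ha
      have : dvrVal F (A i) (algebraMap (A i) F a / algebraMap (A i) F (ϖ i) ^ Z i) ≤ 1 := by
        rw [map_div₀, map_pow, hϖ, ← exp_nsmul]
        refine (div_le_one₀ (zero_lt_iff.2 exp_ne_zero)).2 (ha.trans (exp_le_exp.2 ?_))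
        simp
      obtain ⟨q, hq⟩ := dvrVal_le_one_iff.1 this
      refine ⟨q, IsFractionRing.injective (A i) F ?_⟩
      rw [map_mul, map_pow, hq, mul_div_cancel₀ _ (pow_ne_zero _ hϖ0')]
    rw [h2] at h1
    have hres : IsLocalRing.residue (A i) (ϖ i) = 0 := by
      rw [← dvrVal_algebraMap_lt_one_iff (F := F), hϖ, lt_one_iff_le_exp]
    have hli : LinearIndependent K fun b => IsLocalRing.residue (A i) (θ i b) := by
      simp only [hθ]
      exact (Module.finBasis K (IsLocalRing.ResidueField (A i))).linearIndependent
    have := uniformizer_expansion_injective hϖ0 hres hli (Z i) (fun m b => c ⟨i, m, b⟩)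
      (hdvd _ h1)
    exact congrFun (congrFun this m) b

/-- If the functions `f ^ t * u j` are linearly independent over `K`, the `u j` being finite in
number, then their number is at most the degree of any bound `P` for the poles of `f`: the
functions with `t < l` lie in a space whose dimension grows at most like `l * deg P`. -/
lemma card_le_degree_of_linearIndependent [DecidableEq ι] [Module.Finite K (rrSpace K F A 0)]
    {f : F} {J : Type*} [Fintype J] {u : J → F} {P C : Multiset ι}
    (hfP : ∀ i, dvrVal F (A i) f ≤ exp (P.count i : ℤ))
    (hC : ∀ j i, dvrVal F (A i) (u j) ≤ exp (C.count i : ℤ))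
    (hu : ∀ (l : ℕ) (c : Fin l → J → K),
      ∑ t, ∑ j, c t j • (f ^ (t : ℕ) * u j) = 0 → c = 0) :
    Fintype.card J ≤
      (P.map fun i => Module.finrank K (IsLocalRing.ResidueField (A i))).sum := by
  set d : ι → ℕ := fun i => Module.finrank K (IsLocalRing.ResidueField (A i))
  have key : ∀ l : ℕ, l * Fintype.card J ≤
      Module.finrank K (rrSpace K F A 0) + (l * (P.map d).sum + (C.map d).sum) := by
    intro l
    obtain ⟨h1, h2⟩ := finrank_rrSpace_le (K := K) (F := F) A (l • P + C)
    rw [Multiset.map_add, Multiset.sum_add, Multiset.map_nsmul, Multiset.sum_nsmul,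
      smul_eq_mul] at h2
    refine le_trans ?_ h2
    generalize hD : (fun i => ((l • P + C).count i : ℤ)) = D at h1 ⊢
    have hmem : ∀ p : Fin l × J, f ^ (p.1 : ℕ) * u p.2 ∈ rrSpace K F A D := by
      intro p i
      subst hD
      beta_reduce
      rw [map_mul, map_pow, Multiset.count_add, Multiset.count_nsmul, Nat.cast_add, exp_add]
      refine mul_le_mul' ?_ (hC _ _)
      refine (pow_le_pow_left₀ zero_le (hfP i) _).trans ?_
      rw [← exp_nsmul, exp_le_exp, nsmul_eq_mul, Nat.cast_mul]
      exact Int.mul_le_mul_of_nonneg_right (Int.ofNat_le.2 p.1.2.le) (Int.natCast_nonneg _)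
    have hli : LinearIndependent K fun p : Fin l × J =>
        (⟨f ^ (p.1 : ℕ) * u p.2, hmem p⟩ : rrSpace K F A D) := by
      refine LinearIndependent.of_comp (rrSpace K F A D).subtype ?_
      rw [Fintype.linearIndependent_iff]
      intro c hc p
      rw [Fintype.sum_prod_type] at hc
      exact congrFun (congrFun (hu l (fun t j => c (t, j)) hc) p.1) p.2
    have h3 := hli.fintype_card_le_finrank
    rwa [Fintype.card_prod, Fintype.card_fin] at h3
  by_contra! hlt
  -- A linear inequality valid for every `l` bounds the leading coefficients.
  have h4 := key (Module.finrank K (rrSpace K F A 0) + (C.map d).sum + 1)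
  have h5 : (P.map d).sum + 1 ≤ Fintype.card J := hlt
  have h7 := (Nat.mul_le_mul_left (Module.finrank K (rrSpace K F A 0) + (C.map d).sum + 1)
    h5).trans h4
  rw [mul_add] at h7
  omega

/-- A function has no more zeros than poles: a space of dimension the degree of its zeros remains
independent over the powers of `f`, whereas the poles bound the dimension of the span. -/
lemma degree_zeros_le_degree_poles [Module.Finite K (rrSpace K F A 0)]
    (hfin : ∀ g : F, g ≠ 0 → {i | dvrOrd (A i) g ≠ 0}.Finite)
    (hne : ∀ i j, i ≠ j → ∃ f : F, dvrVal F (A i) f ≤ 1 ∧ ¬ dvrVal F (A j) f ≤ 1)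
    {f : F} (hf : f ≠ 0) (S : Finset ι) (hS : ∀ i, dvrOrd (A i) f ≠ 0 → i ∈ S) :
    ∑ i ∈ S, (dvrOrd (A i) f).toNat * Module.finrank K (IsLocalRing.ResidueField (A i)) ≤
      ∑ i ∈ S, (-dvrOrd (A i) f).toNat * Module.finrank K (IsLocalRing.ResidueField (A i)) := by
  classical
  set Z : ι → ℕ := fun i => (dvrOrd (A i) f).toNat with hZ
  -- The approximation takes place at the zeros of `f` only.
  set T : Finset ι := S.filter fun i => 0 < dvrOrd (A i) f with hT
  obtain ⟨u, hu1, hu⟩ := exists_independent_mod K A hne T Z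
  obtain ⟨C, hC⟩ := exists_pole_bound A hfin u
  set P : Multiset ι := ∑ i ∈ S, Multiset.replicate (-dvrOrd (A i) f).toNat i with hP
  set d : ι → ℕ := fun i => Module.finrank K (IsLocalRing.ResidueField (A i)) with hd
  have hPdeg : (P.map d).sum = ∑ i ∈ S, (-dvrOrd (A i) f).toNat * d i := by
    rw [hP, ← Multiset.coe_mapAddMonoidHom, map_sum, ← Multiset.coe_sumAddMonoidHom, map_sum]
    simp
  have hfP : ∀ i, dvrVal F (A i) f ≤ exp (P.count i : ℤ) := by
    intro i
    rw [dvrVal_le_exp_neg_iff hf, hP, Multiset.count_sum']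
    simp only [Multiset.count_replicate, Finset.sum_ite_eq']
    split_ifs with h
    · omega
    · have := mt (hS i) h
      omega
  have hfT : ∀ i ∈ T, dvrVal F (A i) f ≤ exp (-(Z i : ℤ)) := by
    intro i hi
    have := (Finset.mem_filter.1 hi).2
    rw [dvrVal_le_exp_neg_iff hf]; simp only [hZ]; omega
  have hcard : Fintype.card (Σ i : T, Fin (Z i) × Fin (d i)) = ∑ i ∈ S, Z i * d i := by
    rw [Fintype.card_sigma, hT]
    simp only [Fintype.card_prod, Fintype.card_fin]
    rw [Finset.sum_coe_sort (S.filter fun i => 0 < dvrOrd (A i) f) (fun i => Z i * d i),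
      Finset.sum_filter]
    refine Finset.sum_congr rfl fun i _ => ?_
    split_ifs with h
    · rfl
    · have : Z i = 0 := by simp only [hZ]; omega
      rw [this, zero_mul]
  rw [← hPdeg, ← hcard]
  exact card_le_degree_of_linearIndependent A hfP hC fun l c hc =>
    pow_mul_injective A hf hfT hu1 hu l c hc

/-- A non-zero function has as many zeros as poles, counted with multiplicities and degrees. -/
theorem sum_dvrOrd_mul_degree [Module.Finite K (rrSpace K F A 0)]
    (hfin : ∀ g : F, g ≠ 0 → {i | dvrOrd (A i) g ≠ 0}.Finite)
    (hne : ∀ i j, i ≠ j → ∃ f : F, dvrVal F (A i) f ≤ 1 ∧ ¬ dvrVal F (A j) f ≤ 1)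
    {f : F} (hf : f ≠ 0) (S : Finset ι) (hS : ∀ i, dvrOrd (A i) f ≠ 0 → i ∈ S) :
    ∑ i ∈ S, dvrOrd (A i) f * (Module.finrank K (IsLocalRing.ResidueField (A i)) : ℤ) = 0 := by
  have h1 := degree_zeros_le_degree_poles (K := K) A hfin hne hf S hS
  have h2 := degree_zeros_le_degree_poles (K := K) A hfin hne (inv_ne_zero hf) S
    (fun i hi => hS i (by rwa [dvrOrd_inv, neg_ne_zero] at hi))
  simp only [dvrOrd_inv, neg_neg] at h2
  have h3 := le_antisymm h1 h2
  have h4 : ∀ i, dvrOrd (A i) f = ((dvrOrd (A i) f).toNat : ℤ) - ((-dvrOrd (A i) f).toNat : ℤ) :=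
    fun i => by omega
  calc _ = ∑ i ∈ S, (((dvrOrd (A i) f).toNat *
          Module.finrank K (IsLocalRing.ResidueField (A i)) : ℕ) : ℤ) -
        ∑ i ∈ S, (((-dvrOrd (A i) f).toNat *
          Module.finrank K (IsLocalRing.ResidueField (A i)) : ℕ) : ℤ) := by
        rw [← Finset.sum_sub_distrib]
        refine Finset.sum_congr rfl fun i _ => ?_
        push_cast
        rw [← sub_mul, ← h4]
    _ = 0 := by rw [← Nat.cast_sum, ← Nat.cast_sum, h3, sub_self]

end Family

end DegreeFormula

/-! ### Points of a proper curve -/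

section ProjectiveCurves

attribute [local instance] MvPolynomial.gradedAlgebra

lemma isIso_SpecMap_algebraMap_zero (K : Type u) [Field K] (n : ℕ) :
    IsIso (Spec.map (CommRingCat.ofHom
      (algebraMap K (MvPolynomial.homogeneousSubmodule (Fin (n + 1)) K 0)))) := by
  have hb : Function.Bijective
      (algebraMap K (MvPolynomial.homogeneousSubmodule (Fin (n + 1)) K 0)) := by
    refine ⟨fun a b h => MvPolynomial.C_injective (Fin (n + 1)) K
      (congrArg Subtype.val h), fun p => ?_⟩
    have hp : (p : MvPolynomial (Fin (n + 1)) K) ∈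
        (1 : Submodule K (MvPolynomial (Fin (n + 1)) K)) :=
      MvPolynomial.homogeneousSubmodule_zero (σ := Fin (n + 1)) (R := K) ▸ p.2
    obtain ⟨c, hc⟩ := Submodule.mem_one.1 hp
    exact ⟨c, Subtype.ext hc⟩
  have : IsIso (CommRingCat.ofHom
      (algebraMap K (MvPolynomial.homogeneousSubmodule (Fin (n + 1)) K 0))) :=
    (ConcreteCategory.isIso_iff_bijective _).2 hb
  infer_instance

instance finiteType_homogeneousSubmodule (K : Type u) [Field K] (n : ℕ) :
    Algebra.FiniteType (MvPolynomial.homogeneousSubmodule (Fin (n + 1)) K 0)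
      (MvPolynomial (Fin (n + 1)) K) := by
  have : IsScalarTower K (MvPolynomial.homogeneousSubmodule (Fin (n + 1)) K 0)
      (MvPolynomial (Fin (n + 1)) K) := ⟨fun a p q => smul_mul_assoc a _ q⟩
  exact Algebra.FiniteType.of_restrictScalars_finiteType K _ _

lemma IsProjectiveOver.isProper {K : Type u} [Field K] {X : Scheme.{u}}
    {π : X ⟶ Spec (CommRingCat.of K)} (h : IsProjectiveOver π) : IsProper π := by
  obtain ⟨n, i, hi, rfl⟩ := h
  have := isIso_SpecMap_algebraMap_zero K n
  have : IsProper (projSpaceHom K n) := by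
    unfold projSpaceHom
    infer_instance
  infer_instance

end ProjectiveCurves

section CurveTopology

variable {X : Scheme.{u}} [IsIntegral X]

/-- On a curve, a point other than the generic one is closed: a proper specialization of it would
have coheight at least two. -/
lemma isClosed_singleton_of_ne_genericPoint [IsRegularCurve X] {x : X}
    (hx : x ≠ genericPoint X) : IsClosed ({x} : Set X) := by
  rw [← closure_subset_iff_isClosed]
  intro y hy
  have hxy : x ⤳ y := specializes_iff_mem_closure.2 hy
  by_contra hne
  have hne : y ≠ x := hne
  have hle : ((Order.coheight y : ℕ∞) : WithBot ℕ∞) ≤ 1 := by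
    rw [← Order.coheight_orderIso
      (irreducibleSetEquivPoints (α := X)).symm y, ← IsRegularCurve.dim_eq_one (X := X)]
    exact Order.coheight_le_krullDim _
  have h1 : y < x := lt_of_le_not_ge (show y ≤ x from hxy) fun h : y ⤳ x =>
    hne (h.antisymm hxy).eq
  have h2 : x < genericPoint X := lt_of_le_not_ge
    (show x ≤ genericPoint X from genericPoint_specializes x)
    fun h : x ⤳ genericPoint X => hx (h.antisymm (genericPoint_specializes x)).eq
  have h3 : Order.coheight x + 1 ≤ Order.coheight y := Order.coheight_add_one_le h1
  have h4 : Order.coheight (genericPoint X) + 1 ≤ Order.coheight x := Order.coheight_add_one_le h2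
  have h5 : (2 : ℕ∞) ≤ Order.coheight y := by
    calc (2 : ℕ∞) = 0 + 1 + 1 := by norm_num
      _ ≤ Order.coheight (genericPoint X) + 1 + 1 := by gcongr; exact zero_le
      _ ≤ Order.coheight x + 1 := by gcongr
      _ ≤ _ := h3
  have h6 : Order.coheight y ≤ 1 := by exact_mod_cast hle
  exact absurd (h5.trans h6) (by decide)

instance nonempty_closedPoint [IsRegularCurve X] : Nonempty (ClosedPoint X) := by
  by_contra h
  have hall : ∀ x : X, x = genericPoint X := fun x => by
    by_contra hx
    exact h ⟨⟨x, isClosed_singleton_of_ne_genericPoint hx⟩⟩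
  have hsub : Subsingleton X := ⟨fun a b => by rw [hall a, hall b]⟩
  have := topologicalKrullDim_zero_of_discreteTopology X
  rw [IsRegularCurve.dim_eq_one] at this
  exact absurd this (by decide)

lemma genericPoint_mem {U : X.Opens} (hU : (U : Set X).Nonempty) : genericPoint X ∈ U :=
  let ⟨_, hx⟩ := hU
  (genericPoint_specializes _).mem_open U.isOpen hx

/-- A closed subset of a Noetherian curve which misses the generic point is finite. -/
lemma finite_of_isClosed [IsRegularCurve X] [TopologicalSpace.NoetherianSpace X] {Z : Set X}
    (hZ : IsClosed Z) (hg : genericPoint X ∉ Z) : Z.Finite := by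
  obtain ⟨S, hS, hcl, hirr, rfl⟩ :=
    TopologicalSpace.NoetherianSpace.exists_finite_set_isClosed_irreducible hZ
  refine hS.sUnion fun t ht => ?_
  have hgen := (hirr t ht).isGenericPoint_genericPoint (hcl t ht)
  have hmem : (hirr t ht).genericPoint ∈ t := hgen.mem
  have hne : (hirr t ht).genericPoint ≠ genericPoint X := fun h =>
    hg ⟨t, ht, h ▸ hmem⟩
  have := isClosed_singleton_of_ne_genericPoint hne
  rw [← hgen.def, this.closure_eq]
  exact Set.finite_singleton _

end CurveTopology

section Constants

variable {K : Type u} [Field K] {X : Scheme.{u}} (π : X ⟶ Spec (CommRingCat.of K))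

lemma noetherianSpace_of_isProper [IsProper π] : TopologicalSpace.NoetherianSpace X := by
  have : IsLocallyNoetherian X := LocallyOfFiniteType.isLocallyNoetherian π
  have : CompactSpace X := (quasiCompact_iff_compactSpace π).mp inferInstance
  have : IsNoetherian X := {}
  infer_instance

/-- The homomorphism from `K` to the local ring of `X` at `x`. -/
def constStalk (x : X) : K →+* X.presheaf.stalk x :=
  (X.presheaf.germ ⊤ x trivial).hom.comp
    (π.appTop.hom.comp (Scheme.ΓSpecIso (CommRingCat.of K)).inv.hom)

lemma fromSpecStalk_comp (x : X) :
    X.fromSpecStalk x ≫ π = Spec.map (CommRingCat.ofHom (constStalk π x)) := by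
  have h1 : π = X.toSpecΓ ≫ Spec.map π.appTop ≫
      Spec.map (Scheme.ΓSpecIso (CommRingCat.of K)).inv := by
    rw [← Category.assoc, ← Scheme.toSpecΓ_naturality, Category.assoc]
    simp
  conv_lhs => rw [h1]
  rw [← Category.assoc, Scheme.fromSpecStalk_toSpecΓ, ← Spec.map_comp, ← Spec.map_comp]
  rfl

lemma algebraMap_constStalk [IsIntegral X] (x : X) (c : K) :
    algebraMap (X.presheaf.stalk x) X.functionField (constStalk π x c) =
      constStalk π (genericPoint X) c := by
  have : Nonempty (⊤ : X.Opens) := ⟨⟨genericPoint X, trivial⟩⟩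
  exact Scheme.algebraMap_germ_eq_germToFunctionField (X := X)
    (show x ∈ (⊤ : X.Opens) from trivial) _

/-- The residue field of a closed point is finite over `K`, by Zariski's lemma. -/
lemma toResidueField_finite [LocallyOfFiniteType π] (x : ClosedPoint X) :
    (toResidueField π x.1).Finite := by
  have := isClosed_singleton_iff_isClosedImmersion.mp x.2
  have h := (isFinite_iff_locallyOfFiniteType_of_jacobsonSpace
    (f := X.fromSpecResidueField x.1 ≫ π)).mpr inferInstance
  have h2 : X.fromSpecResidueField x.1 ≫ π =
      Spec.map (CommRingCat.ofHom (toResidueField π x.1)) := by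
    rw [Scheme.fromSpecResidueField, Category.assoc, fromSpecStalk_comp, ← Spec.map_comp]
    rfl
  rw [h2, IsFinite.SpecMap_iff] at h
  exact h

end Constants

/-! ### Orders of rational functions at closed points -/

section DvrUnits

variable {F : Type*} [Field F] {A : Type*} [CommRing A] [IsDomain A] [IsDiscreteValuationRing A]
  [Algebra A F] [IsFractionRing A F]

lemma dvrOrd_nonneg_iff {f : F} (hf : f ≠ 0) :
    0 ≤ dvrOrd A f ↔ ∃ a : A, algebraMap A F a = f := by
  rw [← dvrVal_le_one_iff, ← WithZero.exp_zero, dvrVal_le_exp_neg_iff hf, neg_zero]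

lemma dvrOrd_eq_zero_iff {f : F} (hf : f ≠ 0) :
    dvrOrd A f = 0 ↔ ∃ a : Aˣ, algebraMap A F a = f := by
  refine ⟨fun h => ?_, ?_⟩
  · obtain ⟨a, ha⟩ := (dvrOrd_nonneg_iff (A := A) hf).1 h.ge
    obtain ⟨b, hb⟩ := (dvrOrd_nonneg_iff (A := A) (inv_ne_zero hf)).1
      (by rw [dvrOrd_inv, h, neg_zero])
    refine ⟨Units.mkOfMulEqOne a b (IsFractionRing.injective A F ?_), ha⟩
    rw [map_mul, ha, hb, map_one, mul_inv_cancel₀ hf]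
  · rintro ⟨a, ha⟩
    have h1 := (dvrOrd_nonneg_iff (A := A) hf).2 ⟨a, ha⟩
    have h2 := (dvrOrd_nonneg_iff (A := A) (inv_ne_zero hf)).2
      ⟨((a⁻¹ : Aˣ) : A), by
        rw [← ha]
        exact eq_inv_of_mul_eq_one_left (by rw [← map_mul, Units.inv_mul, map_one])⟩
    rw [dvrOrd_inv] at h2
    omega

variable (F A) in
lemma exists_dvrOrd_eq_one : ∃ ϖ : A, algebraMap A F ϖ ≠ 0 ∧ dvrOrd A (algebraMap A F ϖ) = 1 := by
  obtain ⟨ϖ, h⟩ := exists_uniformizer F A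
  refine ⟨ϖ, fun h0 => ?_, by rw [dvrOrd, h, WithZero.log_exp, neg_neg]⟩
  rw [h0, map_zero] at h
  exact WithZero.exp_ne_zero h.symm

lemma dvrOrd_zpow {f : F} (n : ℤ) : dvrOrd A (f ^ n) = n * dvrOrd A f := by
  rw [dvrOrd, map_zpow₀, WithZero.log_zpow, dvrOrd, smul_eq_mul, mul_neg]

end DvrUnits

section Orders

variable {X : Scheme.{u}} [IsIntegral X] [IsRegularCurve X]

/-- The order of vanishing at a closed point of a rational function; it is `0` for the zero
function. -/
abbrev ordAt (x : ClosedPoint X) (f : X.functionField) : ℤ := dvrOrd (X.presheaf.stalk x.1) f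

lemma ordAt_finite [TopologicalSpace.NoetherianSpace X] {f : X.functionField} (hf : f ≠ 0) :
    {x : ClosedPoint X | ordAt x f ≠ 0}.Finite := by
  obtain ⟨U, -, f', hU, hff, hunit⟩ := exists_isUnit_germ_eq X f hf
  have hne : (U : Set X).Nonempty := let ⟨⟨x, hx⟩⟩ := hU; ⟨x, hx⟩
  refine Set.Finite.subset (Set.Finite.preimage Subtype.val_injective.injOn
    (finite_of_isClosed U.isOpen.isClosed_compl (fun h => h (genericPoint_mem hne)))) ?_
  intro x hx hxU
  refine hx ((dvrOrd_eq_zero_iff hf).2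
    ⟨(hunit.map (X.presheaf.germ U x.1 hxU).hom).unit, ?_⟩)
  rw [IsUnit.unit_spec, ← hff]
  exact Scheme.algebraMap_germ_eq_germToFunctionField X hxU f'

omit [IsRegularCurve X] in
/-- A rational function which is regular at all points is a global regular function. -/
lemma exists_global_section {f : X.functionField}
    (h : ∀ x : X, ∃ a : X.presheaf.stalk x, algebraMap (X.presheaf.stalk x) X.functionField a = f) :
    ∃ s : Γ(X, ⊤), X.presheaf.germ ⊤ (genericPoint X) trivial s = f := by
  choose a ha using h
  choose U hU s hs using fun x => X.presheaf.exists_germ_eq (a x)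
  have hgen : ∀ x, genericPoint X ∈ U x := fun x => genericPoint_mem ⟨x, hU x⟩
  have hgerm : ∀ x, X.presheaf.germ (U x) (genericPoint X) (hgen x) (s x) = f := by
    intro x
    have : Nonempty (U x) := ⟨⟨_, hU x⟩⟩
    rw [← ha x, ← hs x]
    exact (Scheme.algebraMap_germ_eq_germToFunctionField X (hU x) (s x)).symm
  obtain ⟨t, ht, -⟩ := X.sheaf.existsUnique_gluing' U ⊤ (fun x => homOfLE le_top)
    (fun x _ => TopologicalSpace.Opens.mem_iSup.2 ⟨x, hU x⟩) s (by
      intro x y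
      have hxy : genericPoint X ∈ U x ⊓ U y := ⟨hgen x, hgen y⟩
      apply germ_injective_of_isIntegral X (genericPoint X) hxy
      erw [X.presheaf.germ_res_apply, X.presheaf.germ_res_apply, hgerm, hgerm])
  refine ⟨t, ?_⟩
  let x₀ := genericPoint X
  rw [← hgerm x₀, ← ht x₀]
  exact (X.presheaf.germ_res_apply (homOfLE le_top) _ (hgen x₀) t).symm

variable {K : Type u} [Field K] (π : X ⟶ Spec (CommRingCat.of K))

/-- Uniqueness in the valuative criterion: distinct closed points have incomparable local rings. -/
lemma exists_integral_not_integral [IsSeparated π] {x y : ClosedPoint X} (hxy : x ≠ y) :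
    ∃ f : X.functionField, dvrVal X.functionField (X.presheaf.stalk x.1) f ≤ 1 ∧
      ¬ dvrVal X.functionField (X.presheaf.stalk y.1) f ≤ 1 := by
  by_contra! hcon
  have hlift : ∀ a : X.presheaf.stalk x.1, ∃ b : X.presheaf.stalk y.1,
      algebraMap (X.presheaf.stalk y.1) X.functionField b =
        algebraMap (X.presheaf.stalk x.1) X.functionField a :=
    fun a => dvrVal_le_one_iff.1 (hcon _ (dvrVal_le_one_iff.2 ⟨a, rfl⟩))
  choose φ hφ using hlift
  have hinj := IsFractionRing.injective (X.presheaf.stalk y.1) X.functionField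
  let Φ : X.presheaf.stalk x.1 →+* X.presheaf.stalk y.1 :=
    { toFun := φ
      map_one' := hinj (by rw [hφ, map_one, map_one])
      map_mul' := fun a b => hinj (by rw [map_mul, hφ, hφ, hφ, map_mul])
      map_zero' := hinj (by rw [hφ, map_zero, map_zero])
      map_add' := fun a b => hinj (by rw [map_add, hφ, hφ, hφ, map_add]) }
  have hΦ : CommRingCat.ofHom Φ ≫ CommRingCat.ofHom (algebraMap (X.presheaf.stalk y.1)
      X.functionField) = CommRingCat.ofHom (algebraMap (X.presheaf.stalk x.1) X.functionField) := by
    ext a; exact hφ a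
  have hgen : ∀ z : X, Spec.map (CommRingCat.ofHom (algebraMap (X.presheaf.stalk z)
      X.functionField)) ≫ X.fromSpecStalk z = X.fromSpecStalk (genericPoint X) := fun z =>
    Scheme.SpecMap_stalkSpecializes_fromSpecStalk (genericPoint_specializes z)
  have hsq : CommSq (X.fromSpecStalk (genericPoint X)) (Spec.map (CommRingCat.ofHom
      (algebraMap (X.presheaf.stalk y.1) X.functionField))) π (X.fromSpecStalk y.1 ≫ π) :=
    ⟨by rw [← hgen y.1]; exact Category.assoc _ _ _⟩
  have hsub := IsSeparated.valuativeCriterion π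
    { R := X.presheaf.stalk y.1
      commRing := (X.presheaf.stalk y.1).commRing
      domain := inferInstance
      valuationRing := inferInstance
      K := X.functionField, i₁ := X.fromSpecStalk (genericPoint X),
      i₂ := X.fromSpecStalk y.1 ≫ π, commSq := hsq }
  have hfac1 : Spec.map (CommRingCat.ofHom (algebraMap (X.presheaf.stalk y.1)
      X.functionField)) ≫ Spec.map (CommRingCat.ofHom Φ) ≫ X.fromSpecStalk x.1 =
      X.fromSpecStalk (genericPoint X) := by
    refine (Category.assoc _ _ _).symm.trans ?_
    refine (congrArg (· ≫ X.fromSpecStalk x.1) ((Spec.map_comp _ _).symm.trans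
      (congrArg Spec.map hΦ))).trans (hgen x.1)
  have hconst : CommRingCat.ofHom (constStalk π x.1) ≫ CommRingCat.ofHom Φ =
      CommRingCat.ofHom (constStalk π y.1) := by
    ext c
    apply hinj
    change algebraMap _ _ (φ (constStalk π x.1 c)) = algebraMap _ _ (constStalk π y.1 c)
    rw [hφ, algebraMap_constStalk, algebraMap_constStalk]
  have hfac2 : (Spec.map (CommRingCat.ofHom Φ) ≫ X.fromSpecStalk x.1) ≫ π =
      X.fromSpecStalk y.1 ≫ π := by
    rw [Category.assoc, fromSpecStalk_comp, fromSpecStalk_comp, ← Spec.map_comp]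
    exact congrArg Spec.map hconst
  have heq := hsub.elim ⟨X.fromSpecStalk y.1, hgen y.1, rfl⟩
    ⟨Spec.map (CommRingCat.ofHom Φ) ≫ X.fromSpecStalk x.1, hfac1, hfac2⟩
  have heq' : X.fromSpecStalk y.1 = Spec.map (CommRingCat.ofHom Φ) ≫ X.fromSpecStalk x.1 :=
    congrArg (fun l => l.l) heq
  have hy : y.1 ⤳ x.1 := by
    have h1 : y.1 ∈ Set.range (X.fromSpecStalk y.1) := by
      rw [Scheme.range_fromSpecStalk]; exact specializes_rfl
    obtain ⟨p, hp⟩ := h1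
    rw [heq'] at hp
    have h2 : y.1 ∈ Set.range (X.fromSpecStalk x.1) := ⟨_, hp⟩
    rwa [Scheme.range_fromSpecStalk] at h2
  exact hxy (Subtype.ext (hy.mem_closed y.2 rfl))

omit [IsRegularCurve X] in
/-- Existence in the valuative criterion: a valuation ring of `Rat(X)` containing the constants
has a centre on `X`, that is, it dominates a local ring of `X`. -/
lemma exists_center [UniversallyClosed π] (O : ValuationSubring X.functionField)
    (hO : ∀ c : K, constStalk π (genericPoint X) c ∈ O) :
    ∃ x : X, ∀ a : X.presheaf.stalk x,
      algebraMap (X.presheaf.stalk x) X.functionField a ∈ O ∧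
      ((algebraMap (X.presheaf.stalk x) X.functionField a)⁻¹ ∈ O → a ≠ 0 → IsUnit a) := by
  let c' : K →+* O := (constStalk π (genericPoint X)).codRestrict O.toSubring hO
  have hc' : CommRingCat.ofHom c' ≫ CommRingCat.ofHom (algebraMap O X.functionField) =
      CommRingCat.ofHom (constStalk π (genericPoint X)) := rfl
  have hsq : CommSq (X.fromSpecStalk (genericPoint X)) (Spec.map (CommRingCat.ofHom
      (algebraMap O X.functionField))) π (Spec.map (CommRingCat.ofHom c')) :=
    ⟨by
      rw [fromSpecStalk_comp]
      exact (congrArg Spec.map hc').symm.trans (Spec.map_comp _ _)⟩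
  have hex : ValuativeCriterion.Existence π := by
    have h : UniversallyClosed π := inferInstance
    rw [UniversallyClosed.eq_valuativeCriterion] at h
    exact h.1
  obtain ⟨⟨l, hl, -⟩⟩ := hex
    { R := O, K := X.functionField, i₁ := X.fromSpecStalk (genericPoint X),
      i₂ := Spec.map (CommRingCat.ofHom c'), commSq := hsq }
  let x := l (IsLocalRing.closedPoint O)
  let ψ := Scheme.stalkClosedPointTo (R := CommRingCat.of O) l
  have hψ : Spec.map ψ ≫ X.fromSpecStalk x = l := Scheme.Spec_stalkClosedPointTo_fromSpecStalk l
  have hloc : IsLocalHom ψ.hom := inferInstanceAs (IsLocalHom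
    (Scheme.stalkClosedPointTo (R := CommRingCat.of O) l).hom)
  have hcomp : ψ ≫ CommRingCat.ofHom (algebraMap O X.functionField) =
      CommRingCat.ofHom (algebraMap (X.presheaf.stalk x) X.functionField) := by
    apply Spec.map_injective
    rw [← cancel_mono (X.fromSpecStalk x), Spec.map_comp, Category.assoc, hψ]
    refine Eq.trans hl ?_
    exact (Scheme.SpecMap_stalkSpecializes_fromSpecStalk (genericPoint_specializes x)).symm
  have happ : ∀ a : X.presheaf.stalk x, ((ψ.hom a : O) : X.functionField) =
      algebraMap (X.presheaf.stalk x) X.functionField a := fun a =>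
    congrArg (fun g => g.hom a) hcomp
  refine ⟨x, fun a => ⟨by rw [← happ]; exact (ψ.hom a).2, fun hinv ha => ?_⟩⟩
  apply isUnit_of_map_unit ψ.hom
  have hne : algebraMap (X.presheaf.stalk x) X.functionField a ≠ 0 :=
    (map_ne_zero_iff _ (IsFractionRing.injective _ _)).2 ha
  refine IsUnit.of_mul_eq_one ⟨_, hinv⟩ (Subtype.ext ?_)
  change (ψ.hom a : X.functionField) * _ = 1
  rw [happ, mul_inv_cancel₀ hne]

omit [IsRegularCurve X] in
lemma exists_stalk_of_eq_genericPoint {x : X} (hx : x = genericPoint X) (f : X.functionField) :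
    ∃ a : X.presheaf.stalk x, algebraMap (X.presheaf.stalk x) X.functionField a = f := by
  subst hx
  refine ⟨f, ?_⟩
  change (X.presheaf.stalkSpecializes (genericPoint_specializes (genericPoint X))).hom f = f
  rw [X.presheaf.stalkSpecializes_refl]
  rfl

omit [IsRegularCurve X] in
lemma exists_unit_of_eq_genericPoint {x : X} (hx : x = genericPoint X) {f : X.functionField}
    (hf : f ≠ 0) :
    ∃ a : (X.presheaf.stalk x)ˣ, algebraMap (X.presheaf.stalk x) X.functionField a = f := by
  obtain ⟨a, ha⟩ := exists_stalk_of_eq_genericPoint hx f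
  obtain ⟨b, hb⟩ := exists_stalk_of_eq_genericPoint hx f⁻¹
  refine ⟨Units.mkOfMulEqOne a b (IsFractionRing.injective _ X.functionField ?_), ha⟩
  rw [map_mul, ha, hb, map_one, mul_inv_cancel₀ hf]

lemma exists_stalk_of_forall_dvrVal_le_one {f : X.functionField}
    (h : ∀ x : ClosedPoint X, dvrVal X.functionField (X.presheaf.stalk x.1) f ≤ 1) (x : X) :
    ∃ a : X.presheaf.stalk x, algebraMap (X.presheaf.stalk x) X.functionField a = f := by
  by_cases hx : x = genericPoint X
  · exact exists_stalk_of_eq_genericPoint hx f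
  · obtain ⟨y, rfl⟩ : ∃ y : ClosedPoint X, y.1 = x :=
      ⟨⟨x, isClosed_singleton_of_ne_genericPoint hx⟩, rfl⟩
    exact dvrVal_le_one_iff.1 (h y)

/-- The degree of a principal divisor on a regular proper curve is zero. -/
theorem sum_ordAt_mul_residueDegree [IsProper π] {f : X.functionField} (hf : f ≠ 0)
    (S : Finset (ClosedPoint X)) (hS : ∀ x, ordAt x f ≠ 0 → x ∈ S) :
    ∑ x ∈ S, ordAt x f * (residueDegree π x.1 : ℤ) = 0 := by
  let algS : ∀ x : ClosedPoint X, Algebra K (X.presheaf.stalk x.1) :=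
    fun x => (constStalk π x.1).toAlgebra
  let algF : Algebra K X.functionField := (constStalk π (genericPoint X)).toAlgebra
  have : ∀ x : ClosedPoint X, IsScalarTower K (X.presheaf.stalk x.1) X.functionField :=
    fun x => IsScalarTower.of_algebraMap_eq fun c => (algebraMap_constStalk π x.1 c).symm
  have : ∀ x : ClosedPoint X,
      Module.Finite K (IsLocalRing.ResidueField (X.presheaf.stalk x.1)) :=
    fun x => toResidueField_finite π x
  have := noetherianSpace_of_isProper π
  -- The functions without poles are global sections, and `Γ(X, 𝒪_X)` is finite over `K`.
  have : Module.Finite K (rrSpace K X.functionField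
      (fun x : ClosedPoint X => X.presheaf.stalk x.1) 0) := by
    let ρ : K →+* Γ(X, ⊤) := π.appTop.hom.comp (Scheme.ΓSpecIso (CommRingCat.of K)).inv.hom
    have hρ : ρ.Finite := (finite_appTop_of_universallyClosed K π).comp
      (RingHom.Finite.of_surjective _
        (ConcreteCategory.bijective_of_isIso (Scheme.ΓSpecIso (CommRingCat.of K)).inv).2)
    let algΓ : Algebra K Γ(X, ⊤) := ρ.toAlgebra
    have : Module.Finite K Γ(X, ⊤) := hρ
    let L : Γ(X, ⊤) →ₗ[K] X.functionField :=
      { toFun := X.presheaf.germ ⊤ (genericPoint X) trivial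
        map_add' := fun a b => map_add _ a b
        map_smul' := fun c a => (map_mul _ (ρ c) a) }
    have hle : rrSpace K X.functionField (fun x : ClosedPoint X => X.presheaf.stalk x.1) 0 ≤
        LinearMap.range L := by
      intro g hg
      exact exists_global_section (exists_stalk_of_forall_dvrVal_le_one hg)
    exact Module.Finite.of_injective (Submodule.inclusion hle) (Submodule.inclusion_injective hle)
  exact sum_dvrOrd_mul_degree (K := K) (F := X.functionField)
    (fun x : ClosedPoint X => X.presheaf.stalk x.1) (fun g hg => ordAt_finite hg)
    (fun x y hxy => exists_integral_not_integral π hxy) hf S hS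

omit [IsRegularCurve X] in
/-- The integers are constants, so that they have absolute value at most one. -/
lemma isNonarchimedean_of_trivial_on_constants {w : AbsoluteValue X.functionField ℝ}
    (hw : ∀ c : K, c ≠ 0 → w (constStalk π (genericPoint X) c) = 1) :
    IsNonarchimedean w := by
  have h1 : ∀ n : ℕ, ‖(n : WithAbs w)‖ ≤ 1 := by
    intro n
    have : ‖(n : WithAbs w)‖ = w (n : X.functionField) := rfl
    rw [this, ← map_natCast (constStalk π (genericPoint X)) n]
    rcases eq_or_ne (n : K) 0 with h | h
    · rw [h, map_zero]
      erw [map_zero]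
      exact zero_le_one
    · exact (hw _ h).le
  have := IsUltrametricDist.isUltrametricDist_of_forall_norm_natCast_le_one h1
  intro a b
  exact IsUltrametricDist.norm_add_le_max ((WithAbs.equiv w).symm a) ((WithAbs.equiv w).symm b)

/-- The absolute values of `Rat(X)` trivial on `K` are the trivial one and the `e^{-t ord_x}`. -/
theorem abv_classification [IsProper π] (w : AbsoluteValue X.functionField ℝ)
    (hw : ∀ c : K, c ≠ 0 → w (constStalk π (genericPoint X) c) = 1) :
    (∀ f, f ≠ 0 → w f = 1) ∨ ∃ (x : ClosedPoint X) (t : ℝ), 0 < t ∧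
      ∀ f, f ≠ 0 → w f = Real.exp (-t * ordAt x f) := by
  have hna := isNonarchimedean_of_trivial_on_constants π hw
  let O : ValuationSubring X.functionField :=
    { carrier := {f | w f ≤ 1}
      mul_mem' := fun {a b} ha hb => by
        change w (a * b) ≤ 1
        rw [map_mul]; exact mul_le_one₀ ha (w.nonneg b) hb
      one_mem' := (map_one w).le
      add_mem' := fun {a b} ha hb => (hna a b).trans (max_le ha hb)
      zero_mem' := by change w 0 ≤ 1; rw [map_zero]; exact zero_le_one
      neg_mem' := fun {a} ha => by change w (-a) ≤ 1; rw [w.map_neg]; exact ha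
      mem_or_inv_mem' := fun a => by
        change w a ≤ 1 ∨ w a⁻¹ ≤ 1
        rw [map_inv₀]
        rcases le_total (w a) 1 with h | h
        · exact Or.inl h
        · exact Or.inr (inv_le_one_of_one_le₀ h) }
  have hO : ∀ f, f ∈ O ↔ w f ≤ 1 := fun f => Iff.rfl
  -- The local ring of `X` dominated by the valuation ring of `w` determines `w`.
  obtain ⟨x, hx⟩ := exists_center π O fun c => by
    rw [hO]
    rcases eq_or_ne c 0 with h | h
    · rw [h, map_zero]
      erw [map_zero]
      exact zero_le_one
    · exact (hw _ h).le
  simp only [hO] at hx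
  have hunit : ∀ a : (X.presheaf.stalk x)ˣ,
      w (algebraMap (X.presheaf.stalk x) X.functionField a) = 1 := by
    intro a
    refine le_antisymm (hx a).1 ?_
    have h1 := (hx ((a⁻¹ : (X.presheaf.stalk x)ˣ) : X.presheaf.stalk x)).1
    have h2 : w (algebraMap (X.presheaf.stalk x) X.functionField a) *
        w (algebraMap (X.presheaf.stalk x) X.functionField
          ((a⁻¹ : (X.presheaf.stalk x)ˣ) : X.presheaf.stalk x)) = 1 := by
      rw [← map_mul, ← map_mul, Units.mul_inv, map_one, map_one]
    by_contra! hlt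
    have := mul_lt_one_of_nonneg_of_lt_one_left (w.nonneg _) hlt h1
    linarith
  by_cases hgen : x = genericPoint X
  · left
    intro f hf
    obtain ⟨a, rfl⟩ := exists_unit_of_eq_genericPoint hgen hf
    exact hunit a
  · right
    obtain ⟨y, rfl⟩ : ∃ y : ClosedPoint X, y.1 = x :=
      ⟨⟨x, isClosed_singleton_of_ne_genericPoint hgen⟩, rfl⟩
    obtain ⟨ϖ, hϖ0, hϖ⟩ := exists_dvrOrd_eq_one X.functionField (X.presheaf.stalk y.1)
    have hpos : 0 < w (algebraMap (X.presheaf.stalk y.1) X.functionField ϖ) := w.pos hϖ0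
    have hlt : w (algebraMap (X.presheaf.stalk y.1) X.functionField ϖ) < 1 := by
      by_contra! hle
      have h0 : ϖ ≠ 0 := fun h => hϖ0 (by rw [h, map_zero])
      have hu := (hx ϖ).2 (by rw [map_inv₀]; exact inv_le_one_of_one_le₀ hle) h0
      have := (dvrOrd_eq_zero_iff (A := X.presheaf.stalk y.1) hϖ0).2 ⟨hu.unit, rfl⟩
      omega
    refine ⟨y, -Real.log (w (algebraMap (X.presheaf.stalk y.1) X.functionField ϖ)),
      neg_pos.2 (Real.log_neg hpos hlt), fun f hf => ?_⟩
    -- Up to a unit of the local ring, `f` is a power of the uniformizer.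
    set p := algebraMap (X.presheaf.stalk y.1) X.functionField ϖ with hp
    have hpn : p ^ (ordAt y f) ≠ 0 := zpow_ne_zero _ hϖ0
    have hq : f / p ^ (ordAt y f) ≠ 0 := div_ne_zero hf hpn
    have h0 : dvrOrd (X.presheaf.stalk y.1) (f / p ^ (ordAt y f)) = 0 := by
      rw [div_eq_mul_inv, dvrOrd_mul hf (inv_ne_zero hpn), dvrOrd_inv, dvrOrd_zpow, hϖ]
      ring
    obtain ⟨a, ha⟩ := (dvrOrd_eq_zero_iff hq).1 h0
    have h1 := hunit a
    rw [show algebraMap (X.presheaf.stalk y.1) X.functionField a =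
      f / p ^ (ordAt y f) from ha,
      map_div₀, div_eq_one_iff_eq ((w.ne_zero_iff).2 hpn)] at h1
    rw [h1, neg_neg, map_zpow₀, ← Real.rpow_intCast, Real.rpow_def_of_pos hpos]

end Orders

/-! ### Divisors and their degrees -/

section RealExtension

variable {G H : Type*} [AddCommGroup G] [AddCommGroup H]

/-- The `ℝ`-linear extension `G ⊗ ℝ → ℝ` of a homomorphism `G → ℤ`. -/
def extR (φ : G →+ ℤ) : ℝ ⊗[ℤ] G →ₗ[ℝ] ℝ :=
  ((Int.castAddHom ℝ).comp φ).toIntLinearMap.liftBaseChange ℝ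

@[simp]
lemma extR_tmul (φ : G →+ ℤ) (r : ℝ) (a : G) : extR φ (r ⊗ₜ a) = r * φ a := by
  simp [extR]

lemma extR_comp (φ : H →+ ℤ) (ψ : G →+ H) (T : ℝ ⊗[ℤ] G) :
    extR φ (ψ.toIntLinearMap.baseChange ℝ T) = extR (φ.comp ψ) T := by
  induction T using TensorProduct.induction_on with
  | zero => simp
  | tmul r a => simp
  | add S T hS hT => rw [map_add, map_add, map_add, hS, hT]

lemma extR_injective {φ : G →+ ℤ} (hφ : Function.Injective φ) : Function.Injective (extR φ) := by
  have h1 : Function.Injective (φ.toIntLinearMap.lTensor ℝ) :=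
    Module.Flat.lTensor_preserves_injective_linearMap φ.toIntLinearMap hφ
  have h2 : ∀ T, extR φ T = TensorProduct.rid ℤ ℝ (φ.toIntLinearMap.lTensor ℝ T) := by
    intro T
    induction T using TensorProduct.induction_on with
    | zero => simp
    | tmul r a => simp [mul_comm]
    | add S T hS hT => rw [map_add, map_add, map_add, hS, hT]
  intro S T h
  rw [h2, h2] at h
  exact h1 ((TensorProduct.rid ℤ ℝ).injective h)

end RealExtension

section DivisorOrders

variable {X : Scheme.{u}} [IsIntegral X] [IsRegularCurve X]

/-- The order of vanishing at a closed point as a homomorphism on `Rat(X)ˣ`. -/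
def ordHom (x : ClosedPoint X) : RatU X →+ ℤ where
  toFun f := ordAt x ((Additive.toMul f : (X.functionField)ˣ) : X.functionField)
  map_zero' := by simp [ordAt, dvrOrd]
  map_add' f g := by
    rw [toMul_add, Units.val_mul]
    exact dvrOrd_mul (Units.ne_zero _) (Units.ne_zero _)

omit [IsRegularCurve X] in
lemma mem_localUnits_iff (x : X) (f : (X.functionField)ˣ) : f ∈ localUnits X x ↔
    ∃ a : (X.presheaf.stalk x)ˣ, algebraMap (X.presheaf.stalk x) X.functionField a = f := by
  constructor
  · rintro ⟨a, rfl⟩; exact ⟨a, rfl⟩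
  · rintro ⟨a, ha⟩; exact ⟨a, Units.ext ha⟩

lemma mem_localUnits_iff_ordAt (x : ClosedPoint X) (f : (X.functionField)ˣ) :
    f ∈ localUnits X x.1 ↔ ordAt x (f : X.functionField) = 0 := by
  rw [mem_localUnits_iff, dvrOrd_eq_zero_iff f.ne_zero]

/-- The order of vanishing at a closed point on the group `Rat(X)ˣ/𝒪_{X,x}ˣ`. -/
def localOrd (x : ClosedPoint X) : Additive (LocalClass X x.1) →+ ℤ :=
  MonoidHom.toAdditiveLeft (QuotientGroup.lift (localUnits X x.1)
    (AddMonoidHom.toMultiplicativeRight (ordHom x)) fun f hf =>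
      congrArg Multiplicative.ofAdd ((mem_localUnits_iff_ordAt x f).1 hf))

lemma localOrd_classOf (x : ClosedPoint X) (f : (X.functionField)ˣ) :
    localOrd x (Additive.ofMul (classOf X x.1 f)) = ordAt x (f : X.functionField) := rfl

omit [IsRegularCurve X] in
lemma classOf_surjective (x : X) : Function.Surjective (classOf X x) :=
  QuotientGroup.mk'_surjective _

lemma localOrd_injective (x : ClosedPoint X) : Function.Injective (localOrd x) := by
  rw [injective_iff_map_eq_zero]
  intro c hc
  obtain ⟨f, hf⟩ := classOf_surjective x.1 (Additive.toMul c)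
  obtain rfl : Additive.ofMul (classOf X x.1 f) = c := by rw [hf]; rfl
  rw [localOrd_classOf] at hc
  exact congrArg Additive.ofMul ((QuotientGroup.eq_one_iff f).2
    ((mem_localUnits_iff_ordAt x f).2 hc))

omit [IsRegularCurve X] in
lemma subsingleton_localClass {x : X} (hx : x = genericPoint X) :
    Subsingleton (LocalClass X x) := by
  refine ⟨fun a b => ?_⟩
  have h : ∀ c : LocalClass X x, c = 1 := by
    intro c
    obtain ⟨f, rfl⟩ := classOf_surjective x c
    exact (QuotientGroup.eq_one_iff f).2
      ((mem_localUnits_iff x f).2 (exists_unit_of_eq_genericPoint hx f.ne_zero))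
  rw [h a, h b]

/-- The multiplicity at a closed point of a Cartier divisor. -/
def cord (x : ClosedPoint X) : CDiv X →+ ℤ := (localOrd x).comp (germAt X x.1)

lemma cord_eq_of_eq_classOf {x : ClosedPoint X} {D : CDiv X} {f : (X.functionField)ˣ}
    (h : (Additive.toMul D).1 x.1 = classOf X x.1 f) :
    cord x D = ordAt x (f : X.functionField) := by
  rw [← localOrd_classOf, ← h]
  rfl

lemma eq_of_forall_cord_eq {D E : CDiv X} (h : ∀ x, cord x D = cord x E) : D = E := by
  refine congrArg Additive.ofMul (Subtype.ext (funext fun y => ?_) :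
    Additive.toMul D = Additive.toMul E)
  by_cases hy : y = genericPoint X
  · have := subsingleton_localClass hy
    exact Subsingleton.elim _ _
  · obtain ⟨x, rfl⟩ : ∃ x : ClosedPoint X, x.1 = y :=
      ⟨⟨y, isClosed_singleton_of_ne_genericPoint hy⟩, rfl⟩
    exact congrArg Additive.toMul (localOrd_injective x (h x))

section Noetherian

variable [TopologicalSpace.NoetherianSpace X]

omit [IsIntegral X] [IsRegularCurve X] [TopologicalSpace.NoetherianSpace X] in
lemma isClosed_of_finite {S : Set (ClosedPoint X)} (hS : S.Finite) :
    IsClosed (Subtype.val '' S : Set X) := by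
  rw [← Set.biUnion_of_singleton (Subtype.val '' S : Set X)]
  refine (hS.image _).isClosed_biUnion ?_
  rintro _ ⟨x, -, rfl⟩
  exact x.2

/-- A rational function has neither zeros nor poles near `x`, except possibly at `x`. -/
lemma exists_open_ordAt_eq_zero (x : ClosedPoint X) {f : X.functionField} (hf : f ≠ 0) :
    ∃ U : X.Opens, x.1 ∈ U ∧ ∀ y : ClosedPoint X, y.1 ∈ U → y ≠ x → ordAt y f = 0 := by
  have hfin : {y : ClosedPoint X | ordAt y f ≠ 0 ∧ y ≠ x}.Finite :=
    (ordAt_finite hf).subset fun y hy => hy.1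
  refine ⟨⟨_, (isClosed_of_finite hfin).isOpen_compl⟩, ?_, fun y hy hyx => ?_⟩
  · rintro ⟨y, hy, hyx⟩
    exact hy.2 (Subtype.ext hyx)
  · by_contra h
    exact hy ⟨y, ⟨h, hyx⟩, rfl⟩

lemma cord_finite (D : CDiv X) : {x : ClosedPoint X | cord x D ≠ 0}.Finite := by
  obtain ⟨U, hU, f, hf⟩ := (Additive.toMul D).2 (genericPoint X)
  have h1 : {x : ClosedPoint X | x.1 ∉ U}.Finite :=
    Set.Finite.preimage Subtype.val_injective.injOn
      (finite_of_isClosed U.isOpen.isClosed_compl fun h => h hU)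
  refine (h1.union (ordAt_finite f.ne_zero)).subset fun x hx => ?_
  by_cases hxU : x.1 ∈ U
  · refine Or.inr fun h => hx ?_
    rw [cord_eq_of_eq_classOf (hf _ hxU), h]
  · exact Or.inl hxU

/-- Each closed point of a regular curve is an effective Cartier divisor. -/
lemma exists_pointDivisor (x : ClosedPoint X) : ∃ D : CDiv X, IsEffectiveCartier D ∧
    cord x D = 1 ∧ ∀ y, y ≠ x → cord y D = 0 := by
  classical
  obtain ⟨ϖ, hϖ0, hϖ⟩ := exists_dvrOrd_eq_one X.functionField (X.presheaf.stalk x.1)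
  let f : (X.functionField)ˣ := Units.mk0 _ hϖ0
  obtain ⟨U, hxU, hU⟩ := exists_open_ordAt_eq_zero x hϖ0
  obtain ⟨V, hxV, a, ha⟩ := X.presheaf.exists_germ_eq ϖ
  let W : X.Opens := ⟨{x.1}ᶜ, x.2.isOpen_compl⟩
  let D : ∀ y : X, LocalClass X y := fun y => if y = x.1 then classOf X y f else 1
  have hDU : ∀ y ∈ U, D y = classOf X y f := by
    intro y hy
    by_cases hyx : y = x.1
    · exact if_pos hyx
    · refine (if_neg hyx).trans ((QuotientGroup.eq_one_iff f).2 ?_).symm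
      by_cases hgen : y = genericPoint X
      · exact (mem_localUnits_iff y f).2 (exists_unit_of_eq_genericPoint hgen f.ne_zero)
      · exact (mem_localUnits_iff_ordAt ⟨y, isClosed_singleton_of_ne_genericPoint hgen⟩ f).2
          (hU ⟨y, _⟩ hy fun h => hyx (congrArg Subtype.val h))
  have hDW : ∀ y ∈ W, D y = classOf X y 1 := fun y hy => (if_neg hy).trans (map_one _).symm
  have hD : D ∈ cartierGroup X := by
    intro y
    by_cases hyx : y = x.1
    · exact ⟨U, hyx ▸ hxU, f, hDU⟩
    · exact ⟨W, hyx, 1, hDW⟩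
  refine ⟨Additive.ofMul ⟨D, hD⟩, fun y => ?_, ?_, fun y hyx => ?_⟩
  · by_cases hyx : y = x.1
    · subst hyx
      refine ⟨U ⊓ V, ⟨hxU, hxV⟩, X.presheaf.map (homOfLE inf_le_right).op a, f, ?_,
        fun z hz => hDU z hz.1⟩
      exact congrArg (algebraMap (X.presheaf.stalk x.1) X.functionField)
        ((X.presheaf.germ_res_apply (homOfLE inf_le_right) x.1 _ a).trans ha).symm
    · exact ⟨W, hyx, 1, 1, by rw [map_one, map_one]; rfl, hDW⟩
  · exact (cord_eq_of_eq_classOf (D := Additive.ofMul ⟨D, hD⟩) (hDU x.1 hxU)).trans hϖ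
  · refine (cord_eq_of_eq_classOf (D := Additive.ofMul ⟨D, hD⟩)
      (hDW y.1 fun h => hyx (Subtype.ext h))).trans ?_
    simp [ordAt, dvrOrd]

/-- The Cartier divisor of a closed point. -/
def pointDivisor (x : ClosedPoint X) : CDiv X := (exists_pointDivisor x).choose

lemma isEffectiveCartier_pointDivisor (x : ClosedPoint X) :
    IsEffectiveCartier (pointDivisor x) := (exists_pointDivisor x).choose_spec.1

lemma cord_pointDivisor_self (x : ClosedPoint X) : cord x (pointDivisor x) = 1 :=
  (exists_pointDivisor x).choose_spec.2.1

lemma cord_pointDivisor_of_ne {x y : ClosedPoint X} (h : y ≠ x) : cord y (pointDivisor x) = 0 :=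
  (exists_pointDivisor x).choose_spec.2.2 y h

lemma eq_sum_pointDivisor (D : CDiv X) (S : Finset (ClosedPoint X))
    (hS : ∀ x, cord x D ≠ 0 → x ∈ S) : D = ∑ x ∈ S, cord x D • pointDivisor x := by
  refine eq_of_forall_cord_eq fun y => ?_
  simp only [map_sum, map_zsmul]
  by_cases hy : y ∈ S
  · rw [Finset.sum_eq_single y, cord_pointDivisor_self]
    · simp
    · intro x _ hx
      rw [cord_pointDivisor_of_ne hx.symm, smul_zero]
    · exact fun h => absurd hy h
  · rw [Finset.sum_eq_zero, not_not.1 (mt (hS y) hy)]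
    intro x hx
    rw [cord_pointDivisor_of_ne (fun h : y = x => hy (h ▸ hx)), smul_zero]

end Noetherian

/-- The multiplicity at a closed point of an `ℝ`-Cartier divisor. -/
def ordDiv (x : ClosedPoint X) : RDiv X →ₗ[ℝ] ℝ := extR (cord x)

/-- The order of vanishing at a closed point of an `ℝ`-rational function. -/
def ordRat (x : ClosedPoint X) : RRat X →ₗ[ℝ] ℝ := extR (ordHom x)

lemma ordDiv_principalR (x : ClosedPoint X) (s : RRat X) :
    ordDiv x (principalR X s) = ordRat x s := extR_comp (cord x) (principal X) s

/-- Local equations on a regular curve are detected by the orders at the closed points. -/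
lemma isLocalEquation_iff {s : RRat X} {D : RDiv X} {U : X.Opens} :
    IsLocalEquation s D U ↔ ∀ x : ClosedPoint X, x.1 ∈ U → ordDiv x D = ordRat x s := by
  constructor
  · intro h x hx
    have := congrArg (extR (localOrd x)) (h x.1 hx)
    rwa [extR_comp, extR_comp] at this
  · intro h y hy
    by_cases hgen : y = genericPoint X
    · have := subsingleton_localClass hgen
      have : Subsingleton (ℝ ⊗[ℤ] Additive (LocalClass X y)) := by
        refine ⟨fun a b => ?_⟩
        have h0 : ∀ T : ℝ ⊗[ℤ] Additive (LocalClass X y), T = 0 := fun T => by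
          induction T using TensorProduct.induction_on with
          | zero => rfl
          | tmul r a =>
            rw [show a = 0 from Subsingleton.elim (α := LocalClass X y) _ _,
              TensorProduct.tmul_zero]
          | add S T hS hT => rw [hS, hT, add_zero]
        rw [h0 a, h0 b]
      exact Subsingleton.elim _ _
    · obtain ⟨x, rfl⟩ : ∃ x : ClosedPoint X, x.1 = y :=
        ⟨⟨y, isClosed_singleton_of_ne_genericPoint hgen⟩, rfl⟩
      apply extR_injective (localOrd_injective x)
      rw [extR_comp, extR_comp]
      exact h x hy

variable [TopologicalSpace.NoetherianSpace X]

lemma ordRat_finite (s : RRat X) : {x : ClosedPoint X | ordRat x s ≠ 0}.Finite := by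
  induction s using TensorProduct.induction_on with
  | zero => simp
  | tmul r f =>
    refine (ordAt_finite (Units.ne_zero (Additive.toMul f))).subset fun x hx h => hx ?_
    change extR (ordHom x) (r ⊗ₜ f) = 0
    rw [extR_tmul, show ordHom x f = 0 from h, Int.cast_zero, mul_zero]
  | add s t hs ht =>
    refine (hs.union ht).subset fun x hx => ?_
    by_contra h
    rw [Set.mem_union, not_or] at h
    exact hx (by rw [map_add, not_not.1 h.1, not_not.1 h.2, add_zero])

/-- An `ℝ`-Cartier divisor is the combination of the closed points with its multiplicities as
coefficients. -/
lemma exists_eq_sum_ordDiv (D : RDiv X) : ∃ S₀ : Finset (ClosedPoint X),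
    (∀ x ∉ S₀, ordDiv x D = 0) ∧
    ∀ S, S₀ ⊆ S → D = ∑ x ∈ S, ordDiv x D ⊗ₜ[ℤ] pointDivisor x := by
  classical
  induction D using TensorProduct.induction_on with
  | zero => exact ⟨∅, fun _ _ => map_zero _, fun S _ => by simp⟩
  | tmul r D =>
    refine ⟨(cord_finite D).toFinset, fun x hx => ?_, fun S hS => ?_⟩
    · have : cord x D = 0 := by simpa using hx
      rw [ordDiv, extR_tmul, this, Int.cast_zero, mul_zero]
    · conv_lhs => rw [eq_sum_pointDivisor D S (fun x hx => hS (by simpa using hx)),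
        TensorProduct.tmul_sum]
      refine Finset.sum_congr rfl fun x _ => ?_
      rw [← TensorProduct.smul_tmul, ordDiv, extR_tmul, zsmul_eq_mul, mul_comm]
  | add D E hD hE =>
    obtain ⟨S, h1, h2⟩ := hD
    obtain ⟨T, h3, h4⟩ := hE
    refine ⟨S ∪ T, fun x hx => ?_, fun W hW => ?_⟩
    · rw [Finset.mem_union, not_or] at hx
      rw [map_add, h1 x hx.1, h3 x hx.2, add_zero]
    · conv_lhs => rw [h2 W (Finset.union_subset_left hW), h4 W (Finset.union_subset_right hW),
        ← Finset.sum_add_distrib]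
      refine Finset.sum_congr rfl fun x _ => ?_
      rw [map_add, TensorProduct.add_tmul]

lemma ordDiv_finite (D : RDiv X) : {x : ClosedPoint X | ordDiv x D ≠ 0}.Finite := by
  obtain ⟨S, hS, -⟩ := exists_eq_sum_ordDiv D
  refine S.finite_toSet.subset fun x hx => ?_
  by_contra h
  exact hx (hS x h)

/-- An `ℝ`-Cartier divisor with non-negative multiplicities is effective. -/
lemma isEffectiveR_of_ordDiv_nonneg {D : RDiv X} (h : ∀ x, 0 ≤ ordDiv x D) : IsEffectiveR D := by
  classical
  obtain ⟨S, -, hS⟩ := exists_eq_sum_ordDiv D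
  let T := S.filter fun x => ordDiv x D ≠ 0
  refine ⟨T.card, fun i => ordDiv (T.equivFin.symm i : ClosedPoint X) D,
    fun i => pointDivisor (T.equivFin.symm i : ClosedPoint X), fun i => ?_,
    fun i => isEffectiveCartier_pointDivisor _, ?_⟩
  · exact lt_of_le_of_ne (h _) (Finset.mem_filter.1 (T.equivFin.symm i).2).2.symm
  · rw [T.equivFin.symm.sum_comp (fun x : T => ordDiv (x : ClosedPoint X) D ⊗ₜ[ℤ]
      pointDivisor (x : ClosedPoint X)), Finset.sum_coe_sort T
      (fun x => ordDiv x D ⊗ₜ[ℤ] pointDivisor x), Finset.sum_filter_of_ne]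
    · exact hS S subset_rfl
    · intro x _ hx h0
      exact hx (by rw [h0, TensorProduct.zero_tmul])

end DivisorOrders

section Degree

variable {K : Type u} [Field K] {X : Scheme.{u}} [IsIntegral X] [IsRegularCurve X]
  (π : X ⟶ Spec (CommRingCat.of K)) [IsProper π]

omit [AlgebraicGeometry.IsIntegral X] [IsRegularCurve X] in
lemma residueDegree_pos (x : ClosedPoint X) : 0 < residueDegree π x.1 := by
  let alg := (toResidueField π x.1).toAlgebra
  have : Module.Finite K (X.residueField x.1) := toResidueField_finite π x
  exact Module.finrank_pos

/-- The degree of a Cartier divisor, that is, the sum of its multiplicities weighted by the degrees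
of the residue fields; the sum has finite support. -/
def degreeHom [TopologicalSpace.NoetherianSpace X] : CDiv X →+ ℤ where
  toFun D := ∑ᶠ x : ClosedPoint X, cord x D * (residueDegree π x.1 : ℤ)
  map_zero' := by simp
  map_add' D E := by
    have hfin : ∀ D : CDiv X, (Function.support fun x : ClosedPoint X =>
        cord x D * (residueDegree π x.1 : ℤ)).Finite := fun D =>
      (cord_finite D).subset fun x hx h => hx (by simp [h])
    rw [← finsum_add_distrib (hfin D) (hfin E)]
    exact finsum_congr fun x => by rw [map_add, add_mul]

variable [TopologicalSpace.NoetherianSpace X]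

omit [IsProper π] in
lemma degreeHom_pointDivisor (x : ClosedPoint X) :
    degreeHom π (pointDivisor x) = residueDegree π x.1 := by
  change ∑ᶠ y : ClosedPoint X, cord y (pointDivisor x) * (residueDegree π y.1 : ℤ) = _
  rw [finsum_eq_single _ x fun y hy => by rw [cord_pointDivisor_of_ne hy, zero_mul],
    cord_pointDivisor_self, one_mul]

lemma degreeHom_principal (f : RatU X) : degreeHom π (principal X f) = 0 := by
  change ∑ᶠ y : ClosedPoint X, cord y (principal X f) * (residueDegree π y.1 : ℤ) = _
  have hf := Units.ne_zero (Additive.toMul f)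
  have hsub : (Function.support fun y : ClosedPoint X =>
      cord y (principal X f) * (residueDegree π y.1 : ℤ)) ⊆ (ordAt_finite hf).toFinset := by
    intro y hy
    rw [Set.Finite.coe_toFinset]
    exact left_ne_zero_of_mul hy
  rw [finsum_eq_sum_of_support_subset _ hsub]
  exact sum_ordAt_mul_residueDegree π hf _ fun x hx => by simpa using hx

/-- The degree as a homomorphism on `Pic(X)`. -/
def degreePic : PicGroup X →+ ℤ :=
  QuotientAddGroup.lift (principal X).range (degreeHom π) (by
    rintro _ ⟨f, rfl⟩
    exact degreeHom_principal π f)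

lemma extR_degreeHom_principalR (s : RRat X) : extR (degreeHom π) (principalR X s) = 0 := by
  rw [principalR, extR_comp]
  have : (degreeHom π).comp (principal X) = 0 := AddMonoidHom.ext fun f => degreeHom_principal π f
  rw [this]
  induction s using TensorProduct.induction_on with
  | zero => simp
  | tmul r a => simp
  | add S T hS hT => rw [map_add, hS, hT, add_zero]

omit [IsProper π] in
lemma extR_degreeHom_eq_sum (D : RDiv X) (S : Finset (ClosedPoint X))
    (hS : ∀ x, ordDiv x D ≠ 0 → x ∈ S) :
    extR (degreeHom π) D = ∑ x ∈ S, ordDiv x D * residueDegree π x.1 := by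
  classical
  obtain ⟨S₀, -, h⟩ := exists_eq_sum_ordDiv D
  conv_lhs => rw [h (S₀ ∪ S) Finset.subset_union_left, map_sum]
  rw [Finset.sum_subset (Finset.subset_union_right (s₁ := S₀) (s₂ := S))]
  · refine Finset.sum_congr rfl fun x _ => ?_
    rw [extR_tmul, degreeHom_pointDivisor, Int.cast_natCast]
  · intro x _ hx
    rw [not_not.1 (mt (hS x) hx), zero_mul]

/-- The degree of an `ℝ`-principal divisor is zero. -/
lemma sum_ordRat_mul_residueDegree (s : RRat X) (S : Finset (ClosedPoint X))
    (hS : ∀ x, ordRat x s ≠ 0 → x ∈ S) : ∑ x ∈ S, ordRat x s * residueDegree π x.1 = 0 := by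
  rw [← extR_degreeHom_principalR π s, extR_degreeHom_eq_sum π (principalR X s) S]
  · exact Finset.sum_congr rfl fun x _ => by rw [ordDiv_principalR]
  · intro x hx
    exact hS x (by rwa [ordDiv_principalR] at hx)

/-- If `Pic(X) ⊗ ℚ` is one-dimensional, then the degree is injective on `Pic(X) ⊗ ℝ`: an
`ℝ`-Cartier divisor of degree zero is `ℝ`-principal. -/
lemma exists_principalR_eq_of_degree_eq_zero
    (hPic : Module.finrank ℚ (ℚ ⊗[ℤ] PicGroup X) = 1) {D : RDiv X}
    (hD : extR (degreeHom π) D = 0) : ∃ s : RRat X, principalR X s = D := by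
  have hfr : Module.finrank ℝ (ℝ ⊗[ℤ] PicGroup X) = 1 := by
    rw [← (TensorProduct.AlgebraTensorModule.cancelBaseChange ℤ ℚ ℝ ℝ (PicGroup X)).finrank_eq,
      Module.finrank_baseChange, hPic]
  have hfd : FiniteDimensional ℝ (ℝ ⊗[ℤ] PicGroup X) :=
    FiniteDimensional.of_finrank_pos (by rw [hfr]; exact one_pos)
  have hsurj : Function.Surjective (extR (G := PicGroup X) (degreePic π)) := by
    apply LinearMap.surjective
    intro h0
    obtain ⟨x⟩ := (inferInstance : Nonempty (ClosedPoint X))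
    have h1 := LinearMap.congr_fun h0 ((1 : ℝ) ⊗ₜ (QuotientAddGroup.mk' _ (pointDivisor x)))
    rw [extR_tmul, one_mul, LinearMap.zero_apply] at h1
    have h2 : degreePic π (QuotientAddGroup.mk' _ (pointDivisor x)) = residueDegree π x.1 :=
      degreeHom_pointDivisor π x
    rw [h2] at h1
    have := residueDegree_pos π x
    norm_num at h1
    omega
  have hinj : Function.Injective (extR (G := PicGroup X) (degreePic π)) :=
    (LinearMap.injective_iff_surjective_of_finrank_eq_finrank
      (by rw [hfr, Module.finrank_self])).2 hsurj
  let q : CDiv X →+ PicGroup X := QuotientAddGroup.mk' (principal X).range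
  have hex : Function.Exact ((principal X).toIntLinearMap.lTensor ℝ)
      (q.toIntLinearMap.lTensor ℝ) := by
    refine lTensor_exact ℝ ?_ (QuotientAddGroup.mk'_surjective _)
    intro E
    exact QuotientAddGroup.eq_zero_iff E
  refine (hex D).1 (hinj ?_)
  rw [map_zero]
  exact (extR_comp (H := PicGroup X) (degreePic π) q D).trans hD

end Degree

/-! ### The Berkovich space of a curve -/

section AnTopology

open Filter

variable {K : Type u} [Field K] {X : Scheme.{u}} {π : X ⟶ Spec (CommRingCat.of K)}

lemma isOpen_anOpen (U : X.Opens) : IsOpen (anOpen π U) := by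
  refine TopologicalSpace.isOpen_generateFrom_of_mem ⟨U, 0, Set.univ, isOpen_univ, ?_⟩
  ext ξ
  exact ⟨fun h => ⟨h, trivial⟩, fun ⟨h, _⟩ => h⟩

variable [IsIntegral X]

lemma absAt_germ {U : X.Opens} [Nonempty U] (a : Γ(X, U)) (ξ : An π) (h : ξ.pt ∈ U) :
    absAt (X.germToFunctionField U a) ξ = ξ.abv (X.evaluation U ξ.pt h a) := by
  rw [← Scheme.algebraMap_germ_eq_germToFunctionField X h a, absAt_eq]
  rfl

lemma continuousOn_absAt {U : X.Opens} [Nonempty U] (a : Γ(X, U)) :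
    ContinuousOn (absAt (π := π) (X.germToFunctionField U a)) (anOpen π U) := by
  intro ξ hξ
  refine ContinuousAt.continuousWithinAt (continuousAt_def.2 fun V hV => ?_)
  obtain ⟨W, hWV, hW, hξW⟩ := mem_nhds_iff.1 hV
  have hopen : IsOpen {ξ : An π | ∃ h : ξ.pt ∈ U, ξ.abv (X.evaluation U ξ.pt h a) ∈ W} :=
    TopologicalSpace.isOpen_generateFrom_of_mem ⟨U, a, W, hW, rfl⟩
  refine mem_of_superset (hopen.mem_nhds ⟨hξ, (absAt_germ a ξ hξ) ▸ hξW⟩) ?_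
  rintro ξ' ⟨h, hW'⟩
  exact hWV (by rwa [absAt_germ a ξ' h])

lemma absAt_zero (ξ : An π) : absAt (0 : X.functionField) ξ = 0 := by
  rw [← map_zero (algebraMap (X.presheaf.stalk ξ.pt) X.functionField), absAt_eq, map_zero, map_zero]

lemma absAt_pos_of_unit {f : X.functionField} {ξ : An π} (a : (X.presheaf.stalk ξ.pt)ˣ)
    (ha : algebraMap (X.presheaf.stalk ξ.pt) X.functionField a = f) : 0 < absAt f ξ := by
  rw [← ha, absAt_eq]
  exact ξ.abv.pos ((a.isUnit.map (X.residue ξ.pt).hom).ne_zero)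

variable (π) in
/-- The points of `X^an` over the generic point of `X`. -/
def genericFibre : Set (An π) := {ξ | ξ.pt = genericPoint X}

lemma mem_of_genericFibre {ξ : An π} (h : ξ ∈ genericFibre π) {U : X.Opens}
    (hU : (U : Set X).Nonempty) : ξ ∈ anOpen π U := by
  change ξ.pt ∈ U
  rw [show ξ.pt = _ from h]
  exact genericPoint_mem hU

lemma absAt_pos {f : X.functionField} (hf : f ≠ 0) {ξ : An π} (hξ : ξ ∈ genericFibre π) :
    0 < absAt f ξ := by
  obtain ⟨a, ha⟩ := exists_unit_of_eq_genericPoint hξ hf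
  exact absAt_pos_of_unit a ha

lemma algebraMap_stalk_genericPoint (f : X.presheaf.stalk (genericPoint X)) :
    @algebraMap _ _ _ _ (stalkFunctionFieldAlgebra X (genericPoint X)) f = f := by
  change (X.presheaf.stalkSpecializes (genericPoint_specializes (genericPoint X))).hom f = f
  rw [X.presheaf.stalkSpecializes_refl]
  rfl

/-- A point over the generic point of `X`, seen as an absolute value on `Rat(X)`. -/
lemma absAt_mk_genericPoint (w : AbsoluteValue (X.residueField (genericPoint X)) ℝ)
    (hw : ∀ a : K, a ≠ 0 → w (toResidueField π (genericPoint X) a) = 1) (f : X.functionField) :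
    absAt f (⟨genericPoint X, w, hw⟩ : An π) = w (genericResidueEquiv X f) := by
  conv_lhs => rw [← algebraMap_stalk_genericPoint (X := X) f]
  exact absAt_eq (⟨genericPoint X, w, hw⟩ : An π) _

section Tendsto

variable {α : Type*} {l : Filter α} {u : α → An π} {ξ : An π}

/-- Points over the generic point of `X` lie in each `U^an`, so that their convergence in `X^an` is
tested by the functions `|a|`, for `a` regular near the limit. -/
lemma tendsto_an_of_genericFibre (hu : ∀ i, u i ∈ genericFibre π)
    (h : ∀ (U : X.Opens) (_ : Nonempty U) (a : Γ(X, U)), ξ.pt ∈ U →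
      Tendsto (fun i => absAt (X.germToFunctionField U a) (u i)) l
        (𝓝 (absAt (X.germToFunctionField U a) ξ))) : Tendsto u l (𝓝 ξ) := by
  refine TopologicalSpace.tendsto_nhds_generateFrom_iff.2 ?_
  rintro _ ⟨U, a, V, hV, rfl⟩ ⟨hξ, hξV⟩
  have : Nonempty U := ⟨⟨_, hξ⟩⟩
  have h1 := (h U this a hξ).eventually (hV.mem_nhds (by rwa [absAt_germ a ξ hξ]))
  filter_upwards [h1] with i hi
  have hmem : (u i).pt ∈ U := mem_of_genericFibre (hu i) ⟨_, hξ⟩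
  exact ⟨hmem, by rwa [← absAt_germ a _ hmem]⟩

end Tendsto

section Values

lemma valueAt_coe (F : An π → ℝ) (ξ : An π) (hξ : ξ ∈ genericFibre π) :
    valueAt (F : AnGerm π) ξ hξ = F ξ := rfl

lemma valueAt_add (g h : AnGerm π) (ξ : An π) (hξ : ξ ∈ genericFibre π) :
    valueAt (g + h) ξ hξ = valueAt g ξ hξ + valueAt h ξ hξ := by
  induction g using Germ.inductionOn
  induction h using Germ.inductionOn
  rfl

lemma valueAt_sub (g h : AnGerm π) (ξ : An π) (hξ : ξ ∈ genericFibre π) :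
    valueAt (g - h) ξ hξ = valueAt g ξ hξ - valueAt h ξ hξ := by
  induction g using Germ.inductionOn
  induction h using Germ.inductionOn
  rfl

lemma valueAt_smul (r : ℝ) (g : AnGerm π) (ξ : An π) (hξ : ξ ∈ genericFibre π) :
    valueAt (r • g) ξ hξ = r * valueAt g ξ hξ := by
  induction g using Germ.inductionOn
  rfl

lemma logAbsR_tmul (r : ℝ) (f : RatU X) : logAbsR π (r ⊗ₜ f) = r • logAbs π f := by
  simp [logAbsR]

lemma valueAt_logAbsR_tmul (r : ℝ) (f : RatU X) (ξ : An π) (hξ : ξ ∈ genericFibre π) :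
    valueAt (logAbsR π (r ⊗ₜ f)) ξ hξ =
      r * Real.log (absAt ((Additive.toMul f : (X.functionField)ˣ) : X.functionField) ξ) := by
  rw [logAbsR_tmul, valueAt_smul]
  rfl

end Values

section ContinuousClasses

lemma nonempty_inf {U V : X.Opens} (hU : (U : Set X).Nonempty) (hV : (V : Set X).Nonempty) :
    ((U ⊓ V : X.Opens) : Set X).Nonempty :=
  ⟨genericPoint X, genericPoint_mem hU, genericPoint_mem hV⟩

lemma IsContinuousClass.add {g h : AnGerm π} (hg : IsContinuousClass g)
    (hh : IsContinuousClass h) : IsContinuousClass (g + h) := by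
  obtain ⟨U, hU, F, hF, rfl⟩ := hg
  obtain ⟨V, hV, G, hG, rfl⟩ := hh
  exact ⟨U ⊓ V, nonempty_inf hU hV, F + G,
    (hF.mono fun _ h => h.1).add (hG.mono fun _ h => h.2), rfl⟩

lemma IsContinuousClass.smul {g : AnGerm π} (hg : IsContinuousClass g) (r : ℝ) :
    IsContinuousClass (r • g) := by
  obtain ⟨U, hU, F, hF, rfl⟩ := hg
  exact ⟨U, hU, r • F, hF.const_smul r, rfl⟩

lemma isContinuousClass_logAbs (f : RatU X) : IsContinuousClass (logAbs π f) := by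
  obtain ⟨U, -, a, hU, ha, hunit⟩ := exists_isUnit_germ_eq X
    ((Additive.toMul f : (X.functionField)ˣ) : X.functionField) (Units.ne_zero _)
  refine ⟨U, let ⟨⟨x, hx⟩⟩ := hU; ⟨x, hx⟩, _, ?_, rfl⟩
  rw [← ha]
  refine (continuousOn_absAt a).log fun ξ hξ => ?_
  refine (absAt_pos_of_unit (hunit.map (X.presheaf.germ U ξ.pt hξ).hom).unit ?_).ne'
  rw [IsUnit.unit_spec]
  exact Scheme.algebraMap_germ_eq_germToFunctionField X hξ a

lemma isContinuousClass_logAbsR (s : RRat X) : IsContinuousClass (logAbsR π s) := by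
  induction s using TensorProduct.induction_on with
  | zero =>
    rw [map_zero]
    exact ⟨⊤, ⟨genericPoint X, trivial⟩, 0, continuousOn_const, rfl⟩
  | tmul r f => rw [logAbsR_tmul]; exact (isContinuousClass_logAbs f).smul r
  | add s t hs ht => rw [map_add]; exact hs.add ht

end ContinuousClasses

variable [IsRegularCurve X]

section Branches

lemma branchPoint_mem (x : ClosedPoint X) (t : Set.Ioi (0 : ℝ)) :
    branchPoint π x t ∈ genericFibre π := rfl

lemma ordAbv_apply (x : ClosedPoint X) (t : Set.Ioi (0 : ℝ)) {f : X.functionField} (hf : f ≠ 0) :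
    ordAbv x t f = Real.exp (-t.1 * ordAt x f) := by
  have h1 : ordAbv x t f = (WithZeroMulInt.toNNReal (ne_zero_of_lt (one_lt_exp_nnreal t))
      (dvrVal X.functionField (X.presheaf.stalk x.1) f) : ℝ≥0) := rfl
  rw [h1, dvrVal_eq_exp hf, WithZeroMulInt.toNNReal_neg_apply _ WithZero.exp_ne_zero,
    WithZero.toAdd_unzero_eq_log, WithZero.log_exp, NNReal.coe_zpow,
    Real.coe_toNNReal _ (Real.exp_pos _).le, ← Real.rpow_intCast, ← Real.exp_mul]
  congr 1
  push_cast
  ring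

lemma absAt_branchPoint (x : ClosedPoint X) (t : Set.Ioi (0 : ℝ)) {f : X.functionField}
    (hf : f ≠ 0) : absAt f (branchPoint π x t) = Real.exp (-t.1 * ordAt x f) := by
  rw [← ordAbv_apply x t hf]
  refine (absAt_mk_genericPoint _ _ f).trans ?_
  change ordAbv x t ((genericResidueEquiv X).symm (genericResidueEquiv X f)) = _
  rw [RingEquiv.symm_apply_apply]

lemma valueAt_logAbsR_branchPoint (x : ClosedPoint X) (t : Set.Ioi (0 : ℝ)) (s : RRat X) :
    valueAt (logAbsR π s) (branchPoint π x t) rfl = -t.1 * ordRat x s := by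
  induction s using TensorProduct.induction_on with
  | zero => rw [map_zero, map_zero, mul_zero]; rfl
  | tmul r f =>
    rw [valueAt_logAbsR_tmul r f _ (branchPoint_mem x t), absAt_branchPoint x t (Units.ne_zero _),
      Real.log_exp, ordRat, extR_tmul]
    change r * (-t.1 * (ordHom x f : ℝ)) = _
    ring
  | add s u hs hu =>
    rw [map_add, valueAt_add _ _ _ (branchPoint_mem x t), hs, hu, map_add, mul_add]

/-- The points of `X^an` over the generic point of a proper curve are the point `η₀` of the trivial
absolute value and the points of the branches. -/
lemma genericFibre_classification [IsProper π] {ξ : An π} (hξ : ξ ∈ genericFibre π) :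
    (∀ f : X.functionField, f ≠ 0 → absAt f ξ = 1) ∨ ∃ x t, ξ = branchPoint π x t := by
  obtain ⟨p, w, hw⟩ := ξ
  obtain rfl : p = genericPoint X := hξ
  let v : AbsoluteValue X.functionField ℝ :=
    w.comp (f := (genericResidueEquiv X).toRingHom) (genericResidueEquiv X).injective
  have hv : ∀ f, v f = w (genericResidueEquiv X f) := fun f => rfl
  rcases abv_classification π v (fun c hc => hw c hc) with h | ⟨x, t, ht, h⟩
  · exact Or.inl fun f hf => by rw [absAt_mk_genericPoint, ← hv, h f hf]
  · refine Or.inr ⟨x, ⟨t, ht⟩, ?_⟩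
    have heq : w = (branchPoint π x ⟨t, ht⟩).abv := by
      ext r
      obtain ⟨f, rfl⟩ := (genericResidueEquiv X).surjective r
      rcases eq_or_ne f 0 with rfl | hf
      · rw [map_zero, map_zero]
        exact (map_zero (branchPoint π x ⟨t, ht⟩).abv).symm
      · rw [← hv, h f hf]
        exact ((absAt_branchPoint (π := π) x ⟨t, ht⟩ hf).symm).trans
          (absAt_mk_genericPoint _ _ f)
    subst heq
    rfl

omit [AlgebraicGeometry.IsIntegral X] [IsRegularCurve X] in
/-- On the residue field of a closed point, only the trivial absolute value is trivial on `K`. -/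
lemma abv_eq_one_of_isClosed [LocallyOfFiniteType π] (ξ : An π)
    (hξ : IsClosed ({ξ.pt} : Set X)) {r : X.residueField ξ.pt} (hr : r ≠ 0) : ξ.abv r = 1 := by
  let alg := (toResidueField π ξ.pt).toAlgebra
  have hfin : Module.Finite K (X.residueField ξ.pt) := toResidueField_finite π ⟨ξ.pt, hξ⟩
  -- A basis over `K` bounds the absolute value on the whole residue field.
  have hbdd : ∃ C : ℝ, ∀ r, ξ.abv r ≤ C := by
    let b := Module.finBasis K (X.residueField ξ.pt)
    refine ⟨∑ i, ξ.abv (b i), fun r => ?_⟩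
    rw [← b.sum_repr r]
    refine (ξ.abv.sum_le _ _).trans (Finset.sum_le_sum fun i _ => ?_)
    rw [Algebra.smul_def, map_mul]
    refine mul_le_of_le_one_left (ξ.abv.nonneg _) ?_
    rcases eq_or_ne (b.repr r i) 0 with h | h
    · rw [h, map_zero, map_zero]; exact zero_le_one
    · exact (ξ.abv_trivial _ h).le
  obtain ⟨C, hC⟩ := hbdd
  have hle : ∀ r, ξ.abv r ≤ 1 := by
    intro r
    by_contra! hlt
    obtain ⟨n, hn⟩ := pow_unbounded_of_one_lt C hlt
    rw [← map_pow] at hn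
    exact absurd (hC _) (not_le.2 hn)
  refine le_antisymm (hle r) ?_
  have h1 := hle r⁻¹
  rw [map_inv₀] at h1
  exact (inv_le_one₀ (ξ.abv.pos hr)).1 h1

/-- The branch of a closed point `x` tends to the point of `X^an` over `x`. -/
lemma tendsto_branchPoint_of_tendsto_atTop [LocallyOfFiniteType π] (x : ClosedPoint X) {ξ : An π}
    (hξ : ξ.pt = x.1) {t : ℕ → Set.Ioi (0 : ℝ)}
    (ht : Tendsto (fun n => (t n).1) atTop atTop) :
    Tendsto (fun n => branchPoint π x (t n)) atTop (𝓝 ξ) := by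
  refine tendsto_an_of_genericFibre (fun n => branchPoint_mem x (t n)) fun U hU a hξU => ?_
  set f := X.germToFunctionField U a with hf
  have hxU : x.1 ∈ U := hξ ▸ hξU
  rcases eq_or_ne f 0 with h0 | h0
  · simp only [h0, absAt_zero]
    exact tendsto_const_nhds
  simp only [absAt_branchPoint (π := π) x _ h0]
  have hfx : algebraMap (X.presheaf.stalk x.1) X.functionField (X.presheaf.germ U x.1 hxU a) = f :=
    Scheme.algebraMap_germ_eq_germToFunctionField X hxU a
  have hnn : 0 ≤ ordAt x f := (dvrOrd_nonneg_iff h0).2 ⟨_, hfx⟩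
  have hzero : ordAt x f = 0 ↔ X.evaluation U ξ.pt hξU a ≠ 0 := by
    rw [Scheme.evaluation_ne_zero_iff_mem_basicOpen, hξ, X.mem_basicOpen a x.1 hxU,
      dvrOrd_eq_zero_iff h0]
    constructor
    · rintro ⟨b, hb⟩
      rw [IsFractionRing.injective (X.presheaf.stalk x.1) X.functionField (hfx.trans hb.symm)]
      exact b.isUnit
    · intro h
      exact ⟨h.unit, hfx⟩
  rw [absAt_germ a ξ hξU]
  rcases eq_or_lt_of_le hnn with h1 | h1
  · rw [abv_eq_one_of_isClosed ξ (hξ ▸ x.2) (hzero.1 h1.symm), ← h1]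
    simp only [Int.cast_zero, mul_zero, Real.exp_zero]
    exact tendsto_const_nhds
  · have h2 : X.evaluation U ξ.pt hξU a = 0 := by
      by_contra h
      exact h1.ne' (hzero.2 h)
    rw [h2, map_zero]
    refine Real.tendsto_exp_atBot.comp ?_
    simp only [neg_mul]
    exact tendsto_neg_atTop_atBot.comp (ht.atTop_mul_const (by exact_mod_cast h1))

/-- Each branch of `X^an` starts at the point `η₀` of the trivial absolute value. -/
lemma tendsto_branchPoint_of_tendsto_zero (x : ClosedPoint X) {ξ : An π}
    (hξ : ∀ f : X.functionField, f ≠ 0 → absAt f ξ = 1) {t : ℕ → Set.Ioi (0 : ℝ)}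
    (ht : Tendsto (fun n => (t n).1) atTop (𝓝 0)) :
    Tendsto (fun n => branchPoint π x (t n)) atTop (𝓝 ξ) := by
  refine tendsto_an_of_genericFibre (fun n => branchPoint_mem x (t n)) fun U hU a hξU => ?_
  set f := X.germToFunctionField U a with hf
  rcases eq_or_ne f 0 with h0 | h0
  · simp only [h0, absAt_zero]
    exact tendsto_const_nhds
  simp only [absAt_branchPoint (π := π) x _ h0, hξ f h0]
  have := (Real.continuous_exp.tendsto _).comp ((ht.neg).mul_const (ordAt x f : ℝ))
  simpa [Function.comp_def] using this

variable (π) in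
/-- The point of `X^an` over a closed point, given by the trivial absolute value. -/
def closedAn (x : ClosedPoint X) : An π where
  pt := x.1
  abv := by classical exact AbsoluteValue.trivial
  abv_trivial a ha := by
    classical
    exact AbsoluteValue.trivial_apply ((map_ne_zero _).2 ha)

variable (π) in
/-- A point over a closed point `x` is a limit of points of the branch of `x`. -/
lemma dense_genericFibre [LocallyOfFiniteType π] : Dense (genericFibre π) := by
  intro ξ
  by_cases hξ : ξ.pt = genericPoint X
  · exact subset_closure hξ
  · exact mem_closure_of_tendsto (tendsto_branchPoint_of_tendsto_atTop
      ⟨ξ.pt, isClosed_singleton_of_ne_genericPoint hξ⟩ rfl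
      (t := fun n => ⟨(n : ℝ) + 1, Set.mem_Ioi.2 (by positivity)⟩)
      (tendsto_atTop_add_const_right _ _ tendsto_natCast_atTop_atTop))
      (Eventually.of_forall fun n => branchPoint_mem _ _)

end Branches

end AnTopology

/-! ### Green functions and the Dirichlet property -/

section GreenFunctions

open Filter

variable {K : Type u} [Field K] {X : Scheme.{u}} [IsIntegral X] [IsRegularCurve X]
  {π : X ⟶ Spec (CommRingCat.of K)} [TopologicalSpace.NoetherianSpace X]

/-- Each `ℝ`-Cartier divisor `D` has near a closed point `x` the local equation `ϖ ^ c`, with `ϖ` a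
uniformizer at `x` and `c` the multiplicity of `D` at `x`. -/
lemma exists_isLocalEquation (D : RDiv X) (x : ClosedPoint X) :
    ∃ (U : X.Opens) (_ : Nonempty U) (a : Γ(X, U)) (f : (X.functionField)ˣ), x.1 ∈ U ∧
      X.germToFunctionField U a = f ∧ ordAt x (f : X.functionField) = 1 ∧
      IsLocalEquation (ordDiv x D ⊗ₜ[ℤ] (Additive.ofMul f : RatU X)) D U := by
  obtain ⟨ϖ, hϖ0, hϖ⟩ := exists_dvrOrd_eq_one X.functionField (X.presheaf.stalk x.1)
  obtain ⟨f, hf⟩ : ∃ f : (X.functionField)ˣ, (f : X.functionField) = algebraMap _ _ ϖ :=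
    ⟨Units.mk0 _ hϖ0, rfl⟩
  have hfx : ordAt x (f : X.functionField) = 1 := (congrArg (ordAt x) hf).trans hϖ
  obtain ⟨U₁, hxU₁, hU₁⟩ := exists_open_ordAt_eq_zero x f.ne_zero
  obtain ⟨U₂, hxU₂, a, rfl⟩ := X.presheaf.exists_germ_eq ϖ
  have hfin : {y : ClosedPoint X | ordDiv y D ≠ 0 ∧ y ≠ x}.Finite :=
    (ordDiv_finite D).subset fun y hy => hy.1
  let U₃ : X.Opens := ⟨_, (isClosed_of_finite hfin).isOpen_compl⟩
  have hxU₃ : x.1 ∈ U₃ := by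
    rintro ⟨y, hy, hyx⟩
    exact hy.2 (Subtype.ext hyx)
  let U : X.Opens := U₁ ⊓ U₂ ⊓ U₃
  have hxU : x.1 ∈ U := ⟨⟨hxU₁, hxU₂⟩, hxU₃⟩
  have hU : Nonempty U := ⟨⟨_, hxU⟩⟩
  let i : U ⟶ U₂ := homOfLE (inf_le_left.trans inf_le_right)
  refine ⟨U, hU, X.presheaf.map i.op a, f, hxU, ?_, hfx,
    isLocalEquation_iff.2 fun y hy => ?_⟩
  · rw [← Scheme.algebraMap_germ_eq_germToFunctionField X hxU, hf]
    have hres := X.presheaf.germ_res_apply i x.1 hxU a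
    exact congrArg (algebraMap (X.presheaf.stalk x.1) X.functionField) hres
  · change _ = extR (ordHom y) _
    rw [extR_tmul]
    have hord : ordHom y (Additive.ofMul f) = ordAt y (f : X.functionField) := rfl
    rw [hord]
    rcases eq_or_ne y x with rfl | hyx
    · rw [hfx, Int.cast_one, mul_one]
    · rw [hU₁ y hy.1.1 hyx, Int.cast_zero, mul_zero]
      by_contra h
      exact hy.2 ⟨y, ⟨h, hyx⟩, rfl⟩

/-- Near a closed point `x`, a Green function of `D` is `- c log|ϖ|` up to a continuous function,
with `ϖ` a uniformizer at `x` and `c` the multiplicity of `D` at `x`. -/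
lemma exists_local_expression (A : AdelicDivisor π) (x : ClosedPoint X) :
    ∃ (U : X.Opens) (_ : Nonempty U) (a : Γ(X, U)) (h : An π → ℝ), x.1 ∈ U ∧
      ContinuousOn h (anOpen π U) ∧ X.germToFunctionField U a ≠ 0 ∧
      ordAt x (X.germToFunctionField U a) = 1 ∧
      ∀ ξ (hξ : ξ ∈ genericFibre π), valueAt A.g ξ hξ =
        h ξ - ordDiv x A.D * Real.log (absAt (X.germToFunctionField U a) ξ) := by
  obtain ⟨U, hU, a, f, hxU, haf, hf, hloc⟩ := exists_isLocalEquation A.D x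
  obtain ⟨h, hh, hg⟩ := A.isGreen.2 U _ ⟨x.1, hxU⟩ hloc
  refine ⟨U, hU, a, h, hxU, hh, haf ▸ f.ne_zero, haf ▸ hf, fun ξ hξ => ?_⟩
  have := congrArg (fun g => valueAt g ξ hξ) hg
  simp only [valueAt_coe, valueAt_add, valueAt_logAbsR_tmul, toMul_ofMul] at this
  rw [haf, this, add_sub_cancel_right]

omit [AlgebraicGeometry.IsIntegral X] [IsRegularCurve X] [TopologicalSpace.NoetherianSpace X] in
lemma continuousAt_of_mem_anOpen {U : X.Opens} {h : An π → ℝ} (hh : ContinuousOn h (anOpen π U))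
    {ξ : An π} (hξ : ξ.pt ∈ U) : ContinuousAt h ξ :=
  hh.continuousAt ((isOpen_anOpen U).mem_nhds hξ)

/-- The quotient `g(ξ_{x,t})/t` tends to the multiplicity of `D` at `x` as `t` tends to infinity,
so that its infimum `μ_x(g)` is at most this multiplicity. -/
lemma mu_le_ordDiv [LocallyOfFiniteType π] (A : AdelicDivisor π) (x : ClosedPoint X) :
    mu A.g x ≤ (ordDiv x A.D : EReal) := by
  obtain ⟨U, hU, a, h, hxU, hh, ha0, ha, hval⟩ := exists_local_expression A x
  let t : ℕ → Set.Ioi (0 : ℝ) := fun n => ⟨(n : ℝ) + 1, Set.mem_Ioi.2 (by positivity)⟩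
  have ht : Tendsto (fun n => (t n).1) atTop atTop :=
    tendsto_atTop_add_const_right _ _ tendsto_natCast_atTop_atTop
  have hlim : Tendsto (fun n => h (branchPoint π x (t n))) atTop (𝓝 (h (closedAn π x))) :=
    (continuousAt_of_mem_anOpen hh hxU).tendsto.comp
      (tendsto_branchPoint_of_tendsto_atTop x rfl ht)
  have hslope : Tendsto (fun n => valueAt A.g (branchPoint π x (t n)) rfl / (t n).1) atTop
      (𝓝 (ordDiv x A.D)) := by
    have h1 := (hlim.div_atTop ht).add_const (ordDiv x A.D)
    rw [zero_add] at h1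
    refine h1.congr fun n => ?_
    have htn : (t n).1 ≠ 0 := ne_of_gt (t n).2
    rw [hval _ (branchPoint_mem x (t n)), absAt_branchPoint x _ ha0, ha, Real.log_exp]
    field_simp
    push_cast
    ring
  exact ge_of_tendsto ((continuous_coe_real_ereal.tendsto _).comp hslope)
    (Eventually.of_forall fun n => iInf_le _ (t n))

/-- The adelic divisor `(D + (s), g - log|s|)`. -/
def AdelicDivisor.twist (A : AdelicDivisor π) (s : RRat X) : AdelicDivisor π where
  D := A.D + principalR X s
  g := A.g - logAbsR π s
  isGreen := by
    refine ⟨?_, fun U s' hU hs' => ?_⟩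
    · rw [sub_eq_add_neg, ← map_neg]
      exact A.isGreen.1.add (isContinuousClass_logAbsR _)
    · have h := A.isGreen.2 U (s' - s) hU (isLocalEquation_iff.2 fun x hx => ?_)
      · rwa [map_sub, ← add_sub_assoc, add_sub_right_comm] at h
      · rw [map_sub, ← isLocalEquation_iff.1 hs' x hx, map_add, ordDiv_principalR,
          add_sub_cancel_right]

omit [TopologicalSpace.NoetherianSpace X] in
/-- A continuous class which is non-negative on the branches is also non-negative at `η₀`, hence
at all points over the generic point. -/
lemma valueAt_nonneg_of_branches [IsProper π] {g : AnGerm π} (hg : IsContinuousClass g)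
    (h : ∀ x t, 0 ≤ valueAt g (branchPoint π x t) rfl) (ξ : An π) (hξ : ξ ∈ genericFibre π) :
    0 ≤ valueAt g ξ hξ := by
  rcases genericFibre_classification hξ with h0 | ⟨x, t, rfl⟩
  · obtain ⟨U, hU, φ, hφ, rfl⟩ := hg
    obtain ⟨x⟩ : Nonempty (ClosedPoint X) := inferInstance
    have hlim := (continuousAt_of_mem_anOpen hφ (mem_of_genericFibre hξ hU)).tendsto.comp
      (tendsto_branchPoint_of_tendsto_zero x h0
        (t := fun n : ℕ => ⟨1 / ((n : ℝ) + 1), Set.mem_Ioi.2 (by positivity)⟩)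
        tendsto_one_div_add_atTop_nhds_zero_nat)
    exact ge_of_tendsto hlim (Eventually.of_forall fun n => h x _)
  · exact h x t

/-- The function `e^{-g}` has a limit at each point of `X^an` when `D` is effective: near a closed
point `x` it is the product of a continuous function and of `|ϖ| ^ c`, with `c ≥ 0`. -/
lemma exists_tendsto_exp_neg (A : AdelicDivisor π) (hD : ∀ x, 0 ≤ ordDiv x A.D) {U : X.Opens}
    (hU : (U : Set X).Nonempty) {φ : An π → ℝ} (hφ : ContinuousOn φ (anOpen π U))
    (hφg : (φ : AnGerm π) = A.g) (ξ : An π) :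
    ∃ y, Tendsto (fun ξ => Real.exp (-φ ξ)) (𝓝[genericFibre π] ξ) (𝓝 y) := by
  by_cases hξU : ξ.pt ∈ U
  · exact ⟨_, ((continuousAt_of_mem_anOpen hφ hξU).neg.rexp).tendsto.mono_left
      nhdsWithin_le_nhds⟩
  have hξ : ξ.pt ≠ genericPoint X := fun h => hξU (h ▸ genericPoint_mem hU)
  let x : ClosedPoint X := ⟨ξ.pt, isClosed_singleton_of_ne_genericPoint hξ⟩
  obtain ⟨V, hV, a, h, hxV, hh, ha0, -, hval⟩ := exists_local_expression A x
  have h1 : ContinuousAt h ξ := continuousAt_of_mem_anOpen hh hxV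
  have h2 : ContinuousAt (absAt (X.germToFunctionField V a)) ξ :=
    continuousAt_of_mem_anOpen (continuousOn_absAt a) hxV
  have h3 : ContinuousAt (fun ξ => Real.exp (-h ξ) *
      absAt (X.germToFunctionField V a) ξ ^ ordDiv x A.D) ξ :=
    h1.neg.rexp.mul (h2.rpow_const (Or.inr (hD x)))
  refine ⟨_, (h3.tendsto.mono_left nhdsWithin_le_nhds).congr' ?_⟩
  filter_upwards [self_mem_nhdsWithin] with ζ hζ
  have hv := hval ζ hζ
  simp only [← hφg, valueAt_coe] at hv
  rw [hv, Real.rpow_def_of_pos (absAt_pos ha0 hζ), ← Real.exp_add]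
  congr 1
  ring

/-- Over the generic point, the function `e^{-g}` takes values at most `1` when `g` is non-negative
on the branches; by density, so does its continuous extension to `X^an`. -/
lemma isEffective_of_nonneg [IsProper π] (A : AdelicDivisor π) (hD : ∀ x, 0 ≤ ordDiv x A.D)
    (hg : ∀ x t, 0 ≤ valueAt A.g (branchPoint π x t) rfl) : A.IsEffective := by
  refine ⟨isEffectiveR_of_ordDiv_nonneg hD, ?_⟩
  have hpos := valueAt_nonneg_of_branches A.isGreen.1 hg
  obtain ⟨U, hU, φ, hφ, hφg⟩ := A.isGreen.1
  have hlim := exists_tendsto_exp_neg A hD hU hφ hφg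
  set F : An π → ℝ := fun ξ => Real.exp (-φ ξ) with hF
  have hcont : Continuous (extendFrom (genericFibre π) F) :=
    continuous_extendFrom (dense_genericFibre π) hlim
  refine ⟨⟨_, continuous_real_toNNReal.comp hcont⟩, ?_, fun ξ => ?_⟩
  · rw [← hφg, Germ.map_coe]
    refine Germ.coe_eq.2 (mem_comap.2 ⟨U, U.isOpen.mem_nhds (genericPoint_mem hU), ?_⟩)
    intro ξ hξ
    have h1 : extendFrom (genericFibre π) F ξ = F ξ := extendFrom_eq (dense_genericFibre π ξ)
      (((continuousAt_of_mem_anOpen hφ hξ).neg.rexp).tendsto.mono_left nhdsWithin_le_nhds)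
    change ((extendFrom (genericFibre π) F ξ).toNNReal : ℝ) = Real.exp (-φ ξ)
    rw [h1, Real.coe_toNNReal _ (Real.exp_pos _).le]
  · obtain ⟨y, hy⟩ := hlim ξ
    have hne : (𝓝[genericFibre π] ξ).NeBot :=
      mem_closure_iff_nhdsWithin_neBot.1 (dense_genericFibre π ξ)
    have hy1 : y ≤ 1 := by
      refine le_of_tendsto hy ?_
      filter_upwards [self_mem_nhdsWithin] with ζ hζ
      have := hpos ζ hζ
      simp only [← hφg, valueAt_coe] at this
      exact Real.exp_le_one_iff.2 (neg_nonpos.2 this)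
    rw [EReal.neg_nonneg, ENNReal.log_le_zero_iff]
    change ((extendFrom (genericFibre π) F ξ).toNNReal : ℝ≥0∞) ≤ 1
    rw [extendFrom_eq (dense_genericFibre π ξ) hy]
    exact_mod_cast Real.toNNReal_le_one.2 hy1

omit [IsRegularCurve X] [TopologicalSpace.NoetherianSpace X] in
lemma AdelicDivisor.IsEffective.valueAt_nonneg {A : AdelicDivisor π} (hA : A.IsEffective)
    (ξ : An π) (hξ : ξ ∈ genericFibre π) : 0 ≤ valueAt A.g ξ hξ := by
  obtain ⟨-, h, hg, hh⟩ := hA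
  have h1 : h ξ ≤ 1 := by
    have := hh ξ
    rw [EReal.neg_nonneg, ENNReal.log_le_zero_iff] at this
    exact_mod_cast this
  have h2 : valueAt (A.g.map fun r => Real.exp (-r)) ξ hξ = Real.exp (-valueAt A.g ξ hξ) := by
    induction A.g using Germ.inductionOn
    rfl
  rw [← hg, valueAt_coe] at h2
  have h3 : Real.exp (-valueAt A.g ξ hξ) ≤ 1 := by
    rw [← h2]
    exact_mod_cast h1
  exact neg_nonpos.1 (Real.exp_le_one_iff.1 h3)

end GreenFunctions

section Dirichlet

/-- A finite sum of reals is non-negative if and only if its positive part dominates its negative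
part. -/
lemma sum_ofReal_neg_le_iff {ι : Type*} (S : Finset ι) (y : ι → ℝ) :
    ∑ i ∈ S, ENNReal.ofReal (-y i) ≤ ∑ i ∈ S, ENNReal.ofReal (y i) ↔ 0 ≤ ∑ i ∈ S, y i := by
  have h : ∀ z : ι → ℝ, ∑ i ∈ S, ENNReal.ofReal (z i) = ENNReal.ofReal (∑ i ∈ S, (z i)⁺) := by
    intro z
    rw [ENNReal.ofReal_sum_of_nonneg fun i _ => posPart_nonneg (z i)]
    refine Finset.sum_congr rfl fun i _ => ?_
    rw [posPart_def, ENNReal.ofReal_max, ENNReal.ofReal_zero, max_eq_left zero_le]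
  rw [h, h, ENNReal.ofReal_le_ofReal_iff (Finset.sum_nonneg fun i _ => posPart_nonneg _),
    ← sub_nonneg, ← Finset.sum_sub_distrib]
  simp only [posPart_neg, posPart_sub_negPart]

lemma toENNReal_coe_mul_natCast (r : ℝ) (n : ℕ) :
    ((r : EReal) * (n : EReal)).toENNReal =
      ENNReal.ofReal (r * n) := by
  rw [← EReal.coe_coe_eq_natCast, ← EReal.coe_mul, EReal.real_coe_toENNReal]

lemma toENNReal_neg_coe_mul_natCast (r : ℝ) (n : ℕ) :
    (-((r : EReal) * (n : EReal))).toENNReal =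
      ENNReal.ofReal (-(r * n)) := by
  rw [← EReal.coe_coe_eq_natCast, ← EReal.coe_mul, ← EReal.coe_neg, EReal.real_coe_toENNReal]

variable {K : Type u} [Field K] {X : Scheme.{u}} [IsIntegral X] [IsRegularCurve X]
  {π : X ⟶ Spec (CommRingCat.of K)} [IsProper π] [TopologicalSpace.NoetherianSpace X]

omit [IsProper π] [TopologicalSpace.NoetherianSpace X] in
lemma valueAt_sub_logAbsR_branchPoint (g : AnGerm π) (s : RRat X) (x : ClosedPoint X)
    (t : Set.Ioi (0 : ℝ)) : valueAt (g - logAbsR π s) (branchPoint π x t) rfl =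
      valueAt g (branchPoint π x t) rfl + t.1 * ordRat x s := by
  refine (valueAt_sub _ _ _ (branchPoint_mem x t)).trans ?_
  refine (congrArg (valueAt g (branchPoint π x t) rfl - ·)
    (valueAt_logAbsR_branchPoint x t s)).trans ?_
  ring

omit [IsProper π] [TopologicalSpace.NoetherianSpace X] in
lemma neg_ordRat_le_mu {A B : AdelicDivisor π} {s : RRat X} (hB : B.g = A.g - logAbsR π s)
    (hBeff : B.IsEffective) (x : ClosedPoint X) : ((-ordRat x s : ℝ) : EReal) ≤ mu A.g x := by
  refine le_iInf fun t => EReal.coe_le_coe_iff.2 ?_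
  have h := hBeff.valueAt_nonneg (branchPoint π x t) rfl
  rw [hB, valueAt_sub_logAbsR_branchPoint] at h
  rw [le_div_iff₀ t.2]
  linarith

/-- If `(D + (s), g - log|s|)` is effective, then `μ_x(g) ≥ -ord_x(s)` for each `x`, and the sum of
the right-hand sides, weighted by the degrees, is zero. -/
lemma conditions_of_dirichlet {A : AdelicDivisor π} (hA : A.Dirichlet) :
    {x : ClosedPoint X | ¬ 0 ≤ mu A.g x}.Finite ∧ 0 ≤ muTot A.g := by
  obtain ⟨B, ⟨s, -, hB⟩, hBeff⟩ := hA
  have hmu := neg_ordRat_le_mu hB hBeff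
  have hmul : ∀ x, ((-ordRat x s : ℝ) : EReal) * (residueDegree π x.1 : EReal) ≤
      mu A.g x * (residueDegree π x.1 : EReal) := fun x =>
    mul_le_mul_of_nonneg_right (hmu x) (by exact_mod_cast Nat.zero_le _)
  refine ⟨(ordRat_finite s).subset fun x hx h0 => hx ?_, ?_⟩
  · have := hmu x
    rwa [h0, neg_zero] at this
  set S := (ordRat_finite s).toFinset with hS
  have hSmem : ∀ x, ordRat x s ≠ 0 → x ∈ S := fun x hx => (ordRat_finite s).mem_toFinset.2 hx
  have hsum : 0 ≤ ∑ x ∈ S, -ordRat x s * residueDegree π x.1 := by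
    simp only [neg_mul, Finset.sum_neg_distrib]
    rw [sum_ordRat_mul_residueDegree π s S hSmem, neg_zero]
  have hneg : ∑' x : ClosedPoint X, (-(mu A.g x * (residueDegree π x.1 : EReal))).toENNReal ≤
      ∑ x ∈ S, ENNReal.ofReal (-(-ordRat x s * residueDegree π x.1)) := by
    rw [← tsum_eq_sum (L := .unconditional _) (fun x hx => ?_)]
    · refine ENNReal.tsum_le_tsum fun x => ?_
      rw [← toENNReal_neg_coe_mul_natCast]
      exact EReal.toENNReal_le_toENNReal (EReal.neg_le_neg_iff.2 (hmul x))
    · rw [not_not.1 (mt (hSmem x) hx)]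
      simp
  have hpos : ∑ x ∈ S, ENNReal.ofReal (-ordRat x s * residueDegree π x.1) ≤
      ∑' x : ClosedPoint X, (mu A.g x * (residueDegree π x.1 : EReal)).toENNReal := by
    refine le_trans (Finset.sum_le_sum fun x _ => ?_) (ENNReal.sum_le_tsum S)
    rw [← toENNReal_coe_mul_natCast]
    exact EReal.toENNReal_le_toENNReal (hmul x)
  have hneg_top : ∑' x : ClosedPoint X,
      (-(mu A.g x * (residueDegree π x.1 : EReal))).toENNReal ≠ ⊤ :=
    ne_top_of_le_ne_top (ENNReal.sum_ne_top.2 fun _ _ => ENNReal.ofReal_ne_top) hneg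
  rw [muTot, EReal.sub_nonneg (Or.inr (mt EReal.coe_ennreal_eq_top_iff.1 hneg_top))
    (Or.inl (EReal.coe_ennreal_ne_bot _)), EReal.coe_ennreal_le_coe_ennreal_iff]
  exact hneg.trans (((sum_ofReal_neg_le_iff S _).2 hsum).trans hpos)

omit [TopologicalSpace.NoetherianSpace X] in
/-- If the negative parts have a finite sum, then no `μ_x(g)` is `-∞`. -/
lemma mu_ne_bot {A : AdelicDivisor π} (htop : ∑' x : ClosedPoint X,
      (-(mu A.g x * (residueDegree π x.1 : EReal))).toENNReal ≠ ⊤) (x : ClosedPoint X) :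
    mu A.g x ≠ ⊥ := by
  intro h
  refine ENNReal.ne_top_of_tsum_ne_top htop x ?_
  rw [h, EReal.bot_mul_of_pos (by exact_mod_cast residueDegree_pos π x), EReal.neg_bot,
    EReal.toENNReal_top]

/-- Almost all `μ_x(g)` vanish, being non-negative by hypothesis and at most the multiplicity of
`D` at `x`. Thus the `μ_x(g)` form a finitely supported family of real numbers. -/
lemma exists_real_mu {A : AdelicDivisor π}
    (hfin : {x : ClosedPoint X | ¬ 0 ≤ mu A.g x}.Finite) (htot : 0 ≤ muTot A.g) :
    ∃ (M : ClosedPoint X → ℝ) (S : Finset (ClosedPoint X)), (∀ x, (M x : EReal) = mu A.g x) ∧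
      (∀ x ∉ S, M x = 0) ∧ 0 ≤ ∑ x ∈ S, M x * residueDegree π x.1 := by
  classical
  have htop : ∑' x : ClosedPoint X,
      (-(mu A.g x * (residueDegree π x.1 : EReal))).toENNReal ≠ ⊤ := by
    intro h
    rw [muTot, h, EReal.coe_ennreal_top, EReal.sub_top] at htot
    exact absurd htot (by simp)
  rw [muTot, EReal.sub_nonneg (Or.inr (mt EReal.coe_ennreal_eq_top_iff.1 htop))
    (Or.inl (EReal.coe_ennreal_ne_bot _)), EReal.coe_ennreal_le_coe_ennreal_iff] at htot
  obtain ⟨M, hM⟩ : ∃ M : ClosedPoint X → ℝ, ∀ x, (M x : EReal) = mu A.g x :=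
    ⟨fun x => (mu A.g x).toReal, fun x => EReal.coe_toReal
      (ne_top_of_le_ne_top (EReal.coe_ne_top _) (mu_le_ordDiv A x)) (mu_ne_bot htop x)⟩
  have hsupp : {x | M x ≠ 0}.Finite := by
    refine (hfin.union (ordDiv_finite A.D)).subset fun x hx => ?_
    by_contra h
    rw [Set.mem_union, not_or] at h
    have h1 : 0 ≤ mu A.g x := not_not.1 h.1
    have h2 : ordDiv x A.D = 0 := not_not.1 h.2
    have h3 := mu_le_ordDiv A x
    rw [← hM x, h2] at h3
    rw [← hM x] at h1
    exact hx (le_antisymm (EReal.coe_le_coe_iff.1 h3) (EReal.coe_le_coe_iff.1 h1))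
  have hS : ∀ x ∉ hsupp.toFinset, M x = 0 := fun x hx => by
    by_contra h
    exact hx (hsupp.mem_toFinset.2 h)
  refine ⟨M, hsupp.toFinset, hM, hS, (sum_ofReal_neg_le_iff _ _).1 ?_⟩
  simp only [← hM, toENNReal_coe_mul_natCast, toENNReal_neg_coe_mul_natCast] at htot
  rwa [tsum_eq_sum (s := hsupp.toFinset) fun x hx => by simp [hS x hx],
    tsum_eq_sum (s := hsupp.toFinset) fun x hx => by simp [hS x hx]] at htot

/-- A finitely supported family of real numbers with non-negative degree dominates, when the Picard
group has rank one, the orders of an `ℝ`-rational function. -/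
lemma exists_ordRat_le (hPic : Module.finrank ℚ (ℚ ⊗[ℤ] PicGroup X) = 1)
    {M : ClosedPoint X → ℝ} {S : Finset (ClosedPoint X)} (hS : ∀ x ∉ S, M x = 0)
    (hM : 0 ≤ ∑ x ∈ S, M x * residueDegree π x.1) : ∃ s : RRat X, ∀ x, ordRat x s ≤ M x := by
  classical
  obtain ⟨x₀⟩ : Nonempty (ClosedPoint X) := inferInstance
  have hdeg : ∀ x : ClosedPoint X, (0 : ℝ) < residueDegree π x.1 := fun x =>
    Nat.cast_pos.2 (residueDegree_pos π x)
  -- The excess of degree is subtracted at one point.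
  set c : ℝ := (∑ x ∈ S, M x * residueDegree π x.1) / residueDegree π x₀.1 with hc
  have hc0 : 0 ≤ c := div_nonneg hM (hdeg x₀).le
  let E : RDiv X := ∑ x ∈ S, M x ⊗ₜ[ℤ] pointDivisor x - c ⊗ₜ[ℤ] pointDivisor x₀
  have hE : extR (degreeHom π) E = 0 := by
    simp only [E, map_sub, map_sum, extR_tmul, degreeHom_pointDivisor, Int.cast_natCast]
    rw [hc, div_mul_cancel₀ _ (hdeg x₀).ne', sub_self]
  obtain ⟨s, hs⟩ := exists_principalR_eq_of_degree_eq_zero π hPic hE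
  have hpt : ∀ (r : ℝ) (x y : ClosedPoint X),
      ordDiv y (r ⊗ₜ[ℤ] pointDivisor x) = if x = y then r else 0 := by
    intro r x y
    rw [ordDiv, extR_tmul]
    split_ifs with h
    · rw [h, cord_pointDivisor_self, Int.cast_one, mul_one]
    · rw [cord_pointDivisor_of_ne (Ne.symm h), Int.cast_zero, mul_zero]
  refine ⟨s, fun y => ?_⟩
  rw [← ordDiv_principalR, hs]
  simp only [E, map_sub, map_sum, hpt, Finset.sum_ite_eq']
  have h1 : (if y ∈ S then M y else 0) = M y := by
    split_ifs with h
    · rfl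
    · exact (hS y h).symm
  have h2 : 0 ≤ if x₀ = y then c else 0 := by
    split_ifs
    exacts [hc0, le_rfl]
  linarith

/-- If `ord_x(s) ≤ μ_x(g)` for each `x`, then `(D - (s), g + log|s|)` is effective. -/
lemma dirichlet_of_conditions (hPic : Module.finrank ℚ (ℚ ⊗[ℤ] PicGroup X) = 1)
    {A : AdelicDivisor π} (hfin : {x : ClosedPoint X | ¬ 0 ≤ mu A.g x}.Finite)
    (htot : 0 ≤ muTot A.g) : A.Dirichlet := by
  obtain ⟨M, S, hM, hS, hsum⟩ := exists_real_mu hfin htot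
  obtain ⟨s, hs⟩ := exists_ordRat_le hPic hS hsum
  refine ⟨A.twist (-s), ⟨-s, rfl, rfl⟩, isEffective_of_nonneg _ (fun x => ?_) fun x t => ?_⟩
  · have h1 := mu_le_ordDiv A x
    rw [← hM x, EReal.coe_le_coe_iff] at h1
    change 0 ≤ ordDiv x (A.D + principalR X (-s))
    rw [map_add, ordDiv_principalR, map_neg]
    linarith [hs x]
  · have h1 : mu A.g x ≤ _ := iInf_le _ t
    rw [← hM x, EReal.coe_le_coe_iff, le_div_iff₀ t.2] at h1
    change 0 ≤ valueAt (A.g - logAbsR π (-s)) _ _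
    rw [valueAt_sub_logAbsR_branchPoint, map_neg]
    have h2 := mul_le_mul_of_nonneg_right (hs x) (le_of_lt t.2)
    linarith

end Dirichlet

end TrivArak

end

theorem mainTheorem2 {K : Type u} [Field K] {X : AlgebraicGeometry.Scheme.{u}}
    (π : X ⟶ AlgebraicGeometry.Spec (CommRingCat.of K))
    [AlgebraicGeometry.IsIntegral X] [TrivArak.IsRegularCurve X]
    (hproj : TrivArak.IsProjectiveOver π)
    (hPic : Module.finrank ℚ (ℚ ⊗[ℤ] TrivArak.PicGroup X) = 1)
    (A : TrivArak.AdelicDivisor π) :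
    A.Dirichlet ↔
      {x : TrivArak.ClosedPoint X | ¬ 0 ≤ TrivArak.mu A.g x}.Finite ∧
        0 ≤ TrivArak.muTot A.g := by
  have := hproj.isProper
  have := TrivArak.noetherianSpace_of_isProper π
  exact ⟨TrivArak.conditions_of_dirichlet, fun h => TrivArak.dirichlet_of_conditions hPic h.1 h.2⟩
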